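/- Let $\Sigma$ and $\Gamma$ be disjoint finite alphabets (an input and an output alphabet). A language $S \subseteq (\Sigma\cup\Gamma)^*$ defines the relation $[\![S]\!] \subseteq \Sigma^*\times\Gamma^*$ consisting of all pairs $(\pi_{\mathtt i}(w),\pi_{\mathtt o}(w))$ with $w \in S$, where $\pi_{\mathtt i}$ and $\pi_{\mathtt o}$ delete all letters of $\Gamma$ and of $\Sigma$, respectively. A shift of a word $w \in (\Sigma\cup\Gamma)^*$ is a position $1 \le i < |w|$ such that exactly one of the $i$-th and the $(i+1)$-st letter of $w$ is in $\Sigma$; the lag of a position $i$ is the absolute value of the difference between the numbers of input and of output letters among the first $i$ letters of $w$. The shiftlag of $w$ is the largest $n \in \mathbb N$ such that $w$ contains $n$ consecutive shifts all of which have lag at least $n$, and a language has finite shiftlag if the shiftlags of its words are bounded. Automatic relations are the relations $[\![S]\!]$ with $S$ regular of finite shiftlag, and such a relation is given by a nondeterministic finite automaton for $S$. A subsequential transducer has a finite set of states, an initial state, a partial transition function that maps a state and an input letter to an output word and a state, and a set of final states each with a final output word. It computes a partial function $\Sigma^* \to \Gamma^*$, defined on the inputs whose run exists and ends in a final state. Its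 synchronization language consists of all words $a_1v_1a_2v_2\cdots a_nv_nf$ where $a_1\cdots a_n$ is such an input, $v_i$ is the output word of the $i$-th transition and $f$ is the final output word; the transducer has finite shiftlag if its synchronization language has. It uniformizes a relation $R \subseteq \Sigma^*\times\Gamma^*$ if the function it computes has the same domain as $R$ and its graph is contained in $R$. **Theorem.** It is decidable whether a given automatic relation has a uniformization by a subsequential transducer with finite shiftlag. That is, there is an algorithm that, given $\Sigma$, $\Gamma$ and a nondeterministic finite automaton over $\Sigma\cup\Gamma$ whose language $S$ has finite shiftlag, decides whether there is a subsequential transducer with finite shiftlag that uniformizes $[\![S]\!]$. -/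

import Mathlib

/-! Words over the disjoint union of the input alphabet `α` and the output alphabet `β` are lists
over `α ⊕ β`; input letters are `Sum.inl a`, output letters are `Sum.inr b`. -/

namespace Sync

/-- The pair `⟦w⟧ = (π_i(w), π_o(w))` of which `w` is a synchronization. -/
def pairOf {α β : Type*} (w : List (α ⊕ β)) : List α × List β :=
  (w.filterMap Sum.getLeft?, w.filterMap Sum.getRight?)

/-- The relation `⟦S⟧` defined by a synchronization language `S`. -/
def relOf {α β : Type*} (S : Language (α ⊕ β)) : Set (List α × List β) :=
  {p | ∃ w ∈ S, pairOf w = p}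

/-- The lag of position `i` of `w`: the absolute value of the difference between the number of
input letters and the number of output letters among the first `i` letters of `w`. -/
def lagAt {α β : Type*} (w : List (α ⊕ β)) (i : ℕ) : ℕ :=
  (((w.take i).countP Sum.isLeft : ℤ) - ((w.take i).countP Sum.isRight : ℤ)).natAbs

/-- Position `i` (positions are numbered from `1`) is a shift of `w`: `1 ≤ i ≤ |w| - 1`, and exactly
one of the `i`-th and the `(i+1)`-st letter is an input letter. -/
def isShift {α β : Type*} (w : List (α ⊕ β)) (i : ℕ) : Bool :=
  match i with
  | 0 => false
  | j + 1 =>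
    match w[j]?, w[j + 1]? with
    | some x, some y => x.isLeft != y.isLeft
    | _, _ => false

/-- The increasing list of all shifts of `w`. -/
def shifts {α β : Type*} (w : List (α ⊕ β)) : List ℕ :=
  (List.range w.length).filter (isShift w)

/-- `w` contains `n` consecutive shifts each of which is at least `n`-lagged. -/
def HasLaggedShifts {α β : Type*} (w : List (α ⊕ β)) (n : ℕ) : Prop :=
  ∃ l : List ℕ, l <:+: shifts w ∧ l.length = n ∧ ∀ i ∈ l, n ≤ lagAt w i

/-- The shiftlag of a word: the largest `n` such that the word contains `n` consecutive shifts
which are at least `n`-lagged. -/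
noncomputable def wordShiftlag {α β : Type*} (w : List (α ⊕ β)) : ℕ∞ :=
  ⨆ (n : ℕ) (_ : HasLaggedShifts w n), (n : ℕ∞)

/-- The shiftlag of a language: the supremum of the shiftlags of its words. -/
noncomputable def shiftlag {α β : Type*} (S : Language (α ⊕ β)) : ℕ∞ :=
  ⨆ w ∈ S, wordShiftlag w

/-- The language `S` has finite shiftlag. -/
def FiniteShiftlag {α β : Type*} (S : Language (α ⊕ β)) : Prop :=
  shiftlag S < ⊤

/-- A subsequential transducer with input alphabet `α`, output alphabet `β` and states `Q`. The
transition relation is a partial function `Q × α → β* × Q`; the set of final states together with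
the final output function is the partial function `final`. -/
structure SubseqTransducer (α β Q : Type*) where
  start : Q
  step : Q → α → Option (List β × Q)
  final : Q → Option (List β)

namespace SubseqTransducer

/-- The output (with the final output appended) on `u` from state `q`; `none` if there is no run
on `u` from `q` that ends in a final state. -/
def outputFrom {α β Q : Type*} (T : SubseqTransducer α β Q) : Q → List α → Option (List β)
  | q, [] => T.final q
  | q, a :: u =>
    match T.step q a with
    | none => none
    | some (v, p) => (T.outputFrom p u).map fun x => v ++ x

/-- The synchronization `u₁v₁u₂v₂ ⋯ uₙvₙ f(pₙ)` induced by the run on `u` from state `q`; `none` if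
there is no run on `u` from `q` that ends in a final state. -/
def syncFrom {α β Q : Type*} (T : SubseqTransducer α β Q) : Q → List α → Option (List (α ⊕ β))
  | q, [] => (T.final q).map fun v => v.map Sum.inr
  | q, a :: u =>
    match T.step q a with
    | none => none
    | some (v, p) => (T.syncFrom p u).map fun x => Sum.inl a :: (v.map Sum.inr ++ x)

/-- The relation recognized by a subsequential transducer. -/
def relation {α β Q : Type*} (T : SubseqTransducer α β Q) : Set (List α × List β) :=
  {p | T.outputFrom T.start p.1 = some p.2}

/-- The synchronization language of a subsequential transducer. -/
def syncLanguage {α β Q : Type*} (T : SubseqTransducer α β Q) : Language (α ⊕ β) :=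
  {w | ∃ u, T.syncFrom T.start u = some w}

end SubseqTransducer

/-- The domain of a relation. -/
def dom {A B : Type*} (R : Set (A × B)) : Set A :=
  {u | ∃ v, (u, v) ∈ R}

/-- `F` is (the graph of) a uniformization of `R`: a function with the same domain as `R` that
selects for each element of the domain an image with respect to `R`. -/
def IsUniformization {A B : Type*} (F R : Set (A × B)) : Prop :=
  (∀ u v v', (u, v) ∈ F → (u, v') ∈ F → v = v') ∧ dom F = dom R ∧ F ⊆ R

/-- `R` has a uniformization by a (finite-state) subsequential transducer with finite shiftlag. -/
def HasFSLSubseqUniformization {α β : Type*} (R : Set (List α × List β)) : Prop :=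
  ∃ (Q : Type) (_ : Finite Q) (T : SubseqTransducer α β Q),
    IsUniformization T.relation R ∧ FiniteShiftlag T.syncLanguage

/-- A finite description of an NFA over the disjoint union of the input alphabet
`{0, …, inputs - 1}` and the output alphabet `{0, …, outputs - 1}`, with states
`{0, …, states - 1}`. -/
structure NFACode where
  inputs : ℕ
  outputs : ℕ
  states : ℕ
  init : ℕ
  transitions : List (ℕ × (ℕ ⊕ ℕ) × ℕ)
  finals : List ℕ

namespace NFACode

/-- Descriptions of NFAs as tuples. -/
def equivTuple : NFACode ≃ ℕ × ℕ × ℕ × ℕ × List (ℕ × (ℕ ⊕ ℕ) × ℕ) × List ℕ where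
  toFun c := (c.inputs, c.outputs, c.states, c.init, c.transitions, c.finals)
  invFun t := ⟨t.1, t.2.1, t.2.2.1, t.2.2.2.1, t.2.2.2.2.1, t.2.2.2.2.2⟩
  left_inv _ := rfl
  right_inv _ := rfl

instance instPrimcodable : Primcodable NFACode :=
  Primcodable.ofEquiv _ equivTuple

/-- The NFA described by a code. -/
def toNFA (c : NFACode) : NFA (Fin c.inputs ⊕ Fin c.outputs) (Fin c.states) where
  step q x := {p | ((q : ℕ), x.map Fin.val Fin.val, (p : ℕ)) ∈ c.transitions}
  start := {q | (q : ℕ) = c.init}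
  accept := {q | (q : ℕ) ∈ c.finals}

/-- The regular synchronization language described by a code. -/
def language (c : NFACode) : Language (Fin c.inputs ⊕ Fin c.outputs) :=
  c.toNFA.accepts

end NFACode

end Sync

/-! Finite shiftlag makes a regular synchronization language almost synchronous. If an accepting run
of an automaton with state set `Q` has a prefix of lag at least `k = 2 ^ |Q|`, then fewer than `2 *
k` shifts follow, since otherwise pumping would produce words with many shifts of large lag
(`FiniteShiftlag.fewShiftsAfterLag`). Hence a pair `(u, v)` with `|v| ≤ |u|` can be summarized by a
state reached on `u` and a part of `v`, and at most `2 * k` pairs of states between which the rest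
of `v` is read. The set of these summaries determines the residual of the relation `R` after `(u,
v)`; the case `|u| ≤ |v|` is symmetric. So `R` has finitely many residuals, two-sided after pairs of
equal length and one-sided otherwise (`configResidualCode`).

Uniformization becomes a game with lookahead. In a position `(u, v, x)` the pair `(u, v)` of words
of equal length has been committed to, and `x` is input still to be answered. Once a further
nonempty piece `z` of input is known, either `x` is answered by an output of the same length that
loses no input of the domain, and `z` becomes pending, or every remaining input has an image of
bounded length, and all output can wait until the end. A set of positions is `Closed` if such a move
always exists after a fixed amount of lookahead. A transducer with finite shiftlag yields a closed
set, because at any time its output has bounded delay or its total output is no longer than the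
input read so far (`SubseqTransducer.exists_delay_bound`, `SubseqTransducer.exists_closed`).
Conversely, a closed set of bounded positions is played by a finite transducer whose
synchronizations have bounded lag except for a tail with at most one shift
(`Closed.hasFSLSubseqUniformization`).

For decidability, a pending word matters only through its `profile`, the residuals that it can lead
to. There are finitely many profiles, so lookahead and positions can be shortened to a computable
bound (`Closed.exists_bounded`). The same bound suffices for all quantifiers in the definition of a
closed set (`closed_iff_closedB`). It remains to search a finite list of candidates, which is
primitive recursive. -/

namespace Sync

/-! ### Shifts, lag and shiftlag of words -/

section Words

variable {α β : Type*}

/-- The number of input letters minus the number of output letters of a word. -/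
def gain (w : List (α ⊕ β)) : ℤ :=
  (w.countP Sum.isLeft : ℤ) - (w.countP Sum.isRight : ℤ)

@[simp] theorem gain_nil : gain ([] : List (α ⊕ β)) = 0 := by simp [gain]

theorem gain_append (v w : List (α ⊕ β)) : gain (v ++ w) = gain v + gain w := by
  simp only [gain, List.countP_append]; push_cast; ring

theorem lagAt_eq (w : List (α ⊕ β)) (i : ℕ) : lagAt w i = (gain (w.take i)).natAbs := rfl

/-- The number of shifts of a word. -/
def nshift : List (α ⊕ β) → ℕ
  | [] => 0
  | [_] => 0
  | a :: b :: l => (if a.isLeft = b.isLeft then 0 else 1) + nshift (b :: l)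

theorem isShift_cons_succ_succ (a : α ⊕ β) (w : List (α ⊕ β)) (i : ℕ) :
    isShift (a :: w) (i + 2) = isShift w (i + 1) := by
  simp [isShift]

theorem length_shifts (w : List (α ⊕ β)) : (shifts w).length = nshift w := by
  induction w with
  | nil => rfl
  | cons a w ih =>
    cases w with
    | nil => rfl
    | cons b l =>
      have h0 : isShift (a :: b :: l) 1 = (a.isLeft != b.isLeft) := rfl
      have hz : ∀ w : List (α ⊕ β), isShift w 0 = false := fun _ => rfl
      simp only [shifts, List.length_cons, List.range_succ_eq_map, List.filter_cons, hz,
        List.filter_map, nshift] at ih ⊢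
      simp only [Bool.false_eq_true, if_false, Function.comp_def, List.length_map,
        Nat.succ_eq_add_one, zero_add, h0, isShift_cons_succ_succ] at ih ⊢
      rw [← ih]
      by_cases h : a.isLeft = b.isLeft <;> simp [h, add_comm]

theorem isShift_append_right (v w : List (α ⊕ β)) (i : ℕ) :
    isShift (v ++ w) (v.length + (i + 1)) = isShift w (i + 1) := by
  have h1 : (v ++ w)[v.length + i]? = w[i]? := by
    rw [List.getElem?_append_right (by omega)]; congr 1; omega
  have h2 : (v ++ w)[v.length + i + 1]? = w[i + 1]? := by
    rw [List.getElem?_append_right (by omega)]; congr 1; omega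
  show isShift (v ++ w) ((v.length + i) + 1) = _
  simp only [isShift, h1, h2]

theorem isShift_append_of_isShift (v w x : List (α ⊕ β)) (i : ℕ) (h : isShift w i = true) :
    isShift (v ++ (w ++ x)) (v.length + i) = true := by
  cases i with
  | zero => simp [isShift] at h
  | succ j =>
    rw [isShift_append_right]
    simp only [isShift] at h ⊢
    have h2 : j + 1 < w.length := by
      by_contra hc
      rw [List.getElem?_eq_none (l := w) (i := j + 1) (by omega)] at h
      cases hw : w[j]? <;> simp [hw] at h
    rw [List.getElem?_append_left (by omega), List.getElem?_append_left h2]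
    exact h

/-- The shifts at positions `v.length + j` with `j < w.length` are consecutive among all shifts.
They include the shifts inside `w`, and possibly one more at the border of `v` and `w`, so there are
at least `nshift w` of them. -/
theorem hasLaggedShifts_of_nshift {v w x : List (α ⊕ β)} {n : ℕ} (hn : n ≤ nshift w)
    (hlag : ∀ t, t <+: w → n ≤ (gain (v ++ t)).natAbs) : HasLaggedShifts (v ++ (w ++ x)) n := by
  set S := (List.range w.length).filter fun j => isShift (v ++ (w ++ x)) (v.length + j) with hS
  have hsub : (shifts w).length ≤ S.length := by
    rw [shifts, hS, ← List.countP_eq_length_filter, ← List.countP_eq_length_filter]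
    apply List.countP_mono_left
    intro j _ h
    exact isShift_append_of_isShift v w x j h
  rw [length_shifts] at hsub
  refine ⟨(S.map (v.length + ·)).take n, ?_, ?_, ?_⟩
  · refine (List.take_prefix _ _).isInfix.trans ?_
    rw [shifts, List.length_append, List.length_append, List.range_add, List.range_add,
      List.filter_append, List.map_append]
    rw [hS, ← Function.comp_def (isShift (v ++ (w ++ x))), ← List.filter_map, List.filter_append]
    exact List.infix_append' _ _ _
  · simp; omega
  · intro i hi
    have hi := List.mem_of_mem_take hi
    obtain ⟨j, hj, rfl⟩ := List.mem_map.1 hi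
    have hj' : j < w.length := by simpa using (List.mem_filter.1 hj).1
    rw [lagAt_eq]
    have : (v ++ (w ++ x)).take (v.length + j) = v ++ w.take j := by
      rw [List.take_append, List.take_of_length_le (by omega)]
      congr 1
      rw [Nat.add_sub_cancel_left, List.take_append_of_le_length hj'.le]
    rw [this]
    exact hlag _ (List.take_prefix _ _)

/-- If `n` exceeds the lag bound `B` on `v`, then no `n`-lagged shift lies within `v` or at its
right border, so all of them are shifts of `w`. -/
theorem le_of_hasLaggedShifts {v w : List (α ⊕ β)} {n B : ℕ} (h : HasLaggedShifts (v ++ w) n)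
    (hB : ∀ t, t <+: v → (gain t).natAbs ≤ B) : n ≤ max B (nshift w) := by
  by_contra hc
  obtain ⟨l, hl, hlen, hlag⟩ := h
  have hnB : B < n := by omega
  have hsub : l.Sublist (shifts (v ++ w)) := hl.sublist
  have hpos : ∀ i ∈ l, v.length < i := by
    intro i hi
    by_contra hle
    have := hlag i hi
    rw [lagAt_eq, List.take_append_of_le_length (by omega)] at this
    have := hB _ (List.take_prefix i v)
    omega
  have hnd : (shifts (v ++ w)).Nodup := List.nodup_range.filter _
  have hle : l.length ≤ ((shifts w).map (v.length + ·)).length := by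
    apply List.Subperm.length_le
    apply List.subperm_of_subset (hsub.nodup hnd)
    intro i hi
    have h1 := hpos i hi
    have h2 := List.mem_filter.1 (hsub.subset hi)
    obtain ⟨j, rfl⟩ : ∃ j, i = v.length + (j + 1) := ⟨i - v.length - 1, by omega⟩
    rw [isShift_append_right] at h2
    refine List.mem_map.2 ⟨j + 1, List.mem_filter.2 ⟨?_, h2.2⟩, rfl⟩
    simpa using h2.1
  rw [List.length_map, length_shifts] at hle
  omega

theorem finiteShiftlag_iff {S : Language (α ⊕ β)} :
    FiniteShiftlag S ↔ ∃ n : ℕ, ∀ w ∈ S, ∀ m, HasLaggedShifts w m → m ≤ n := by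
  unfold FiniteShiftlag shiftlag wordShiftlag
  constructor
  · intro h
    obtain ⟨n, hn⟩ := ENat.ne_top_iff_exists.1 h.ne
    refine ⟨n, fun w hw m hm => ?_⟩
    have : (m : ℕ∞) ≤ n := by
      rw [hn]
      exact le_iSup₂_of_le w hw (le_iSup₂_of_le m hm le_rfl)
    exact_mod_cast this
  · rintro ⟨n, hn⟩
    refine lt_of_le_of_lt (b := (n : ℕ∞)) ?_ (ENat.natCast_lt_top n)
    exact iSup₂_le fun w hw => iSup₂_le fun m hm => by exact_mod_cast hn w hw m hm

end Words

/-! ### Runs of automata and pumping of additive weights -/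

section Runs

variable {A Q : Type*}

/-- `Run M p w q`: the automaton `M` has a run on `w` from `p` to `q`. -/
def Run (M : NFA A Q) : Q → List A → Q → Prop
  | p, [], q => p = q
  | p, a :: w, q => ∃ r ∈ M.step p a, Run M r w q

theorem run_append {M : NFA A Q} {p q : Q} {v w : List A} :
    Run M p (v ++ w) q ↔ ∃ r, Run M p v r ∧ Run M r w q := by
  induction v generalizing p with
  | nil => simp [Run]
  | cons a v ih =>
    simp only [List.cons_append, Run, ih]
    constructor
    · rintro ⟨r, hr, s, h1, h2⟩; exact ⟨s, ⟨r, hr, h1⟩, h2⟩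
    · rintro ⟨s, ⟨r, hr, h1⟩, h2⟩; exact ⟨r, hr, s, h1, h2⟩

theorem mem_evalFrom_iff_run {M : NFA A Q} {S : Set Q} {w : List A} {q : Q} :
    q ∈ M.evalFrom S w ↔ ∃ p ∈ S, Run M p w q := by
  induction w generalizing S with
  | nil => simp [Run]
  | cons a w ih =>
    simp only [NFA.evalFrom_cons, ih, NFA.mem_stepSet, Run]
    constructor
    · rintro ⟨r, ⟨p, hp, hr⟩, h⟩; exact ⟨p, hp, r, hr, h⟩
    · rintro ⟨p, hp, r, hr, h⟩; exact ⟨r, ⟨p, hp, hr⟩, h⟩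

theorem mem_accepts_iff_run {M : NFA A Q} {w : List A} :
    w ∈ M.accepts ↔ ∃ p ∈ M.start, ∃ q ∈ M.accept, Run M p w q := by
  simp only [NFA.mem_accepts, mem_evalFrom_iff_run]
  tauto

theorem run_congr {M M' : NFA A Q} (h : M.step = M'.step) {p q : Q} {w : List A} :
    Run M p w q ↔ Run M' p w q := by
  induction w generalizing p with
  | nil => rfl
  | cons a w ih => simp only [Run, h, ih]

/-- This is the pumping lemma for the automaton with only start state `p` and only final state `q`.
The bound counts sets of states because the lemma for nondeterministic automata passes through the
subset construction. -/
theorem exists_run_pump [Fintype Q] {M : NFA A Q} {p q : Q} {w : List A} (h : Run M p w q)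
    (hlen : Fintype.card (Set Q) ≤ w.length) :
    ∃ a b c, w = a ++ b ++ c ∧ b ≠ [] ∧
      ∀ n, Run M p (a ++ (List.replicate n b).flatten ++ c) q := by
  have key : ∀ w, w ∈ (NFA.mk M.step {p} {q}).accepts ↔ Run M p w q := fun w => by
    rw [mem_accepts_iff_run]
    simp only [Set.mem_singleton_iff, exists_eq_left]
    exact run_congr (show (NFA.mk M.step {p} {q}).step = M.step from rfl)
  obtain ⟨a, b, c, h1, -, h3, h4⟩ := NFA.pumping_lemma ((key w).2 h) hlen
  refine ⟨a, b, c, h1, h3, fun n => (key _).1 (h4 ?_)⟩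
  refine Language.mem_mul.2 ⟨_, Language.mem_mul.2 ⟨a, rfl, _, ?_, rfl⟩, c, rfl, rfl⟩
  rw [Language.mem_kstar]
  exact ⟨_, rfl, fun y hy => List.eq_of_mem_replicate hy⟩

/-- A run whose weight is at least the number of sets of states can be replaced by runs of
arbitrarily large weight, if the weight is additive and letters have weight at most `1`. -/
theorem exists_run_of_weight_ge [Fintype Q] {M : NFA A Q} {p q : Q} {w : List A}
    (h : Run M p w q) (wt : A → ℤ) (hwt : ∀ a, wt a ≤ 1)
    (hw : (Fintype.card (Set Q) : ℤ) ≤ (w.map wt).sum) (n : ℕ) :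
    ∃ w', Run M p w' q ∧ (n : ℤ) ≤ (w'.map wt).sum := by
  induction hl : w.length using Nat.strong_induction_on generalizing w with
  | _ l ih =>
    have hle : (w.map wt).sum ≤ w.length := by
      clear h hw hl
      induction w with
      | nil => simp
      | cons a w ih => have := hwt a; simp; omega
    obtain ⟨a, b, c, rfl, hb, hrun⟩ := exists_run_pump h (by omega)
    -- A factor of positive weight is repeated, often enough to outweigh a negative weight of `a ++
    -- c`. A factor of nonpositive weight is removed, which does not decrease the weight and
    -- shortens the word.
    by_cases hpos : 0 < (b.map wt).sum
    · have hsum : ∀ k : ℕ, ((((List.replicate k b).flatten).map wt).sum) =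
          k * (b.map wt).sum := by
        intro k; simp
      refine ⟨_, hrun (n + (((a ++ c).map wt).sum).natAbs), ?_⟩
      simp only [List.map_append, List.sum_append, hsum]
      push_cast
      have h1 : -((a.map wt).sum + (c.map wt).sum) ≤ |(a.map wt).sum + (c.map wt).sum| :=
        neg_le_abs _
      have h2 := abs_nonneg ((a.map wt).sum + (c.map wt).sum)
      nlinarith
    · have h0 := hrun 0
      simp only [List.replicate_zero, List.flatten_nil, List.append_nil] at h0
      have hbl : 0 < b.length := List.length_pos_iff.2 hb
      refine ih (a ++ c).length ?_ h0 ?_ rfl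
      · rw [← hl]; simp; omega
      · simp only [List.map_append, List.sum_append] at hw ⊢
        omega

end Runs

/-! ### Few shifts follow a large lag -/

section Pumping

variable {α β Q : Type*}

theorem gain_eq_sum (w : List (α ⊕ β)) :
    gain w = (w.map (Sum.elim (fun _ => (1 : ℤ)) fun _ => -1)).sum := by
  induction w with
  | nil => simp
  | cons a w ih =>
    rw [← List.singleton_append, gain_append, ih]
    cases a <;> simp [gain]

theorem nshift_le_append_left (v w : List (α ⊕ β)) : nshift w ≤ nshift (v ++ w) := by
  induction v with
  | nil => simp
  | cons a v ih =>
    refine ih.trans ?_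
    cases h : v ++ w with
    | nil => simp [nshift]
    | cons b l => simp [h, nshift]

theorem nshift_add_le_append (v w : List (α ⊕ β)) :
    nshift v + nshift w ≤ nshift (v ++ w) := by
  induction v with
  | nil => simp [nshift]
  | cons a v ih =>
    cases v with
    | nil => simpa [nshift] using nshift_le_append_left [a] w
    | cons b v => simp only [List.cons_append, nshift] at ih ⊢; omega

/-- Cutting off a shortest prefix that contains a shift costs that shift and at most one more at the
cut; hence the factor `2`. -/
theorem exists_nshift_pos_prefix (w : List (α ⊕ β)) (n : ℕ) (h : 2 * n ≤ nshift w) :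
    ∃ (l : List (List (α ⊕ β))) (r : List (α ⊕ β)), w = l.flatten ++ r ∧ l.length = n ∧
      ∀ b ∈ l, 1 ≤ nshift b := by
  induction n generalizing w with
  | zero => exact ⟨[], w, by simp⟩
  | succ n ih =>
    have first : ∀ w : List (α ⊕ β), 1 ≤ nshift w → ∃ b r, w = b ++ r ∧ 1 ≤ nshift b ∧
        nshift w ≤ nshift r + 2 := by
      intro w hw
      induction w with
      | nil => simp [nshift] at hw
      | cons a w ih =>
        cases w with
        | nil => simp [nshift] at hw
        | cons c l =>
          by_cases hac : a.isLeft = c.isLeft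
          · simp only [nshift, hac, if_true, zero_add] at hw
            obtain ⟨b, r, h1, h2, h3⟩ := ih hw
            refine ⟨a :: b, r, by simp [h1], h2.trans (nshift_le_append_left [a] b), ?_⟩
            simpa [nshift, hac] using h3
          · refine ⟨[a, c], l, rfl, by simp [nshift, hac], ?_⟩
            cases l with
            | nil => simp [nshift, hac]
            | cons d l => simp only [nshift]; split_ifs <;> omega
    obtain ⟨b, r, rfl, hb, hr⟩ := first w (by omega)
    obtain ⟨l, r', rfl, hl, hl'⟩ := ih r (by omega)
    exact ⟨b :: l, r', by simp, by simp [hl], by simpa using ⟨hb, hl'⟩⟩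

/-- The number of shifts is only superadditive, so it is not a weight of letters. The word is cut
into factors that contain a shift, and these factors are taken as the letters, each of weight `1`,
of a new automaton `M'` on the same states. -/
theorem exists_run_nshift_ge [Fintype Q] {M : NFA (α ⊕ β) Q} {p q : Q} {w : List (α ⊕ β)}
    (h : Run M p w q) (hw : 2 * Fintype.card (Set Q) ≤ nshift w) (n : ℕ) :
    ∃ w', Run M p w' q ∧ n ≤ nshift w' := by
  obtain ⟨l, r, rfl, hl, hb⟩ := exists_nshift_pos_prefix w _ hw
  obtain ⟨s, h1, h2⟩ := run_append.1 h
  let M' : NFA {b : List (α ⊕ β) // 1 ≤ nshift b} Q := ⟨fun q b => {r | Run M q b.1 r}, ∅, ∅⟩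
  have key : ∀ (l : List {b : List (α ⊕ β) // 1 ≤ nshift b}) (p : Q),
      Run M' p l s ↔ Run M p (l.map Subtype.val).flatten s := by
    intro l
    induction l with
    | nil => intro p; rfl
    | cons b l ih =>
      intro p
      simp only [Run, ih, List.map_cons, List.flatten_cons, run_append]
      rfl
  lift l to List {b : List (α ⊕ β) // 1 ≤ nshift b} using hb
  obtain ⟨l', h3, h4⟩ := exists_run_of_weight_ge ((key _ _).2 h1) (fun _ => 1) (fun _ => le_rfl)
    (by rw [List.length_map] at hl; simp [-Fintype.card_set, hl]) n
  refine ⟨_, run_append.2 ⟨s, (key _ _).1 h3, h2⟩, ?_⟩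
  have h5 : ∀ l : List {b : List (α ⊕ β) // 1 ≤ nshift b},
      l.length ≤ nshift (l.map Subtype.val).flatten := by
    intro l
    induction l with
    | nil => simp
    | cons b l ih =>
      have := nshift_add_le_append b.1 (l.map Subtype.val).flatten
      have := b.2
      simp only [List.map_cons, List.flatten_cons, List.length_cons]
      omega
  have := h5 l'
  have := nshift_add_le_append (l'.map Subtype.val).flatten r
  simp at h4
  omega

/-- After a position of large lag, accepting runs have few shifts. -/
def FewShiftsAfterLag (M : NFA (α ⊕ β) Q) (k : ℕ) : Prop :=
  ∀ ⦃q₀ p f : Q⦄ ⦃v w : List (α ⊕ β)⦄, q₀ ∈ M.start → f ∈ M.accept → Run M q₀ v p →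
    Run M p w f → k ≤ (gain v).natAbs → nshift w < 2 * k

/-- Otherwise `w` can be pumped to have arbitrarily many shifts and, independently, `v` to have
arbitrarily large lag, which contradicts finite shiftlag. -/
theorem FiniteShiftlag.fewShiftsAfterLag [Fintype Q] {M : NFA (α ⊕ β) Q}
    (h : FiniteShiftlag M.accepts) : FewShiftsAfterLag M (Fintype.card (Set Q)) := by
  obtain ⟨n, hn⟩ := finiteShiftlag_iff.1 h
  intro q₀ p f v w hq₀ hf hv hw hgain
  by_contra hc
  obtain ⟨w', hw', hs⟩ := exists_run_nshift_ge hw (not_lt.1 hc) (n + 1)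
  -- The second factor `w'` is fixed first. A letter changes the gain by at most one, so the surplus
  -- `w'.length` keeps the lag large throughout `w'`. The sign of the gain decides which letters
  -- count as positive weight.
  obtain ⟨v', hv', hg⟩ : ∃ v', Run M q₀ v' p ∧ n + 1 + w'.length ≤ (gain v').natAbs := by
    rcases le_total 0 (gain v) with h0 | h0
    · obtain ⟨v', h1, h2⟩ := exists_run_of_weight_ge hv
        (Sum.elim (fun _ => (1 : ℤ)) fun _ => -1) (by rintro (a | a) <;> simp)
        (by rw [← gain_eq_sum]; omega) (n + 1 + w'.length)
      rw [← gain_eq_sum] at h2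
      exact ⟨v', h1, by omega⟩
    · have hneg : ∀ v : List (α ⊕ β),
          (v.map (Sum.elim (fun _ => (-1 : ℤ)) fun _ => 1)).sum = - gain v := by
        intro v
        rw [gain_eq_sum]
        induction v with
        | nil => simp
        | cons a v ih =>
          cases a <;> simp only [List.map_cons, List.sum_cons, ih, Sum.elim_inl, Sum.elim_inr] <;>
            ring
      obtain ⟨v', h1, h2⟩ := exists_run_of_weight_ge hv
        (Sum.elim (fun _ => (-1 : ℤ)) fun _ => 1) (by rintro (a | a) <;> simp)
        (by rw [hneg]; omega) (n + 1 + w'.length)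
      rw [hneg] at h2
      exact ⟨v', h1, by omega⟩
  have := hn (v' ++ (w' ++ [])) (mem_accepts_iff_run.2
    ⟨q₀, hq₀, f, hf, by simpa using run_append.2 ⟨p, hv', hw'⟩⟩) (n + 1)
    (hasLaggedShifts_of_nshift hs fun t ht => ?_)
  · omega
  · have hle := ht.length_le
    have h1 : (gain t).natAbs ≤ t.length := by
      have h2 : t.countP Sum.isLeft ≤ t.length := List.countP_le_length
      have h3 : t.countP Sum.isRight ≤ t.length := List.countP_le_length
      simp only [gain]; omega
    rw [gain_append]
    omega

end Pumping

/-! ### Residuals of relations -/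

section Residuals

variable {α β : Type*}

/-- The residual of a relation after reading a pair of words. -/
def res (R : Set (List α × List β)) (u : List α) (v : List β) : Set (List α × List β) :=
  {p | (u ++ p.1, v ++ p.2) ∈ R}

/-- The residual of a relation after a pair of words, for continuations of the input only. -/
def resIn (R : Set (List α × List β)) (u : List α) (v : List β) : Set (List α) :=
  {x | (u ++ x, v) ∈ R}

/-- The residual of a relation after a pair of words, for continuations of the output only. -/
def resOut (R : Set (List α × List β)) (u : List α) (v : List β) : Set (List β) :=
  {y | (u, v ++ y) ∈ R}

/-- A code of pairs of words that determines the residuals of `R`. -/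
structure ResidualCode (R : Set (List α × List β)) (X : Type*) where
  code : List α → List β → X
  res_eq : ∀ {u v u' v'}, u.length = v.length → u'.length = v'.length →
    code u v = code u' v' → res R u v = res R u' v'
  resIn_eq : ∀ {u v u' v'}, v.length ≤ u.length → v'.length ≤ u'.length →
    code u v = code u' v' → resIn R u v = resIn R u' v'
  resOut_eq : ∀ {u v u' v'}, u.length ≤ v.length → u'.length ≤ v'.length →
    code u v = code u' v' → resOut R u v = resOut R u' v'

end Residuals

/-! ### Pairs of words and their synchronizations -/

section PairOf

variable {α β : Type*}

theorem pairOf_append (v w : List (α ⊕ β)) :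
    pairOf (v ++ w) = ((pairOf v).1 ++ (pairOf w).1, (pairOf v).2 ++ (pairOf w).2) := by
  simp [pairOf]

@[simp] theorem pairOf_nil : pairOf ([] : List (α ⊕ β)) = ([], []) := rfl

@[simp] theorem pairOf_inl_cons (a : α) (w : List (α ⊕ β)) :
    pairOf (Sum.inl a :: w) = (a :: (pairOf w).1, (pairOf w).2) := rfl

@[simp] theorem pairOf_inr_cons (b : β) (w : List (α ⊕ β)) :
    pairOf (Sum.inr b :: w) = ((pairOf w).1, b :: (pairOf w).2) := rfl

@[simp] theorem pairOf_map_inl (u : List α) :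
    pairOf (u.map Sum.inl : List (α ⊕ β)) = (u, []) := by
  induction u with
  | nil => rfl
  | cons a u ih => simp [ih]

@[simp] theorem pairOf_map_inr (v : List β) :
    pairOf (v.map Sum.inr : List (α ⊕ β)) = ([], v) := by
  induction v with
  | nil => rfl
  | cons a u ih => simp [ih]

theorem gain_eq_pairOf (w : List (α ⊕ β)) :
    gain w = ((pairOf w).1.length : ℤ) - (pairOf w).2.length := by
  rw [gain_eq_sum]
  induction w with
  | nil => simp
  | cons a w ih => cases a <;> simp [ih] <;> ring

theorem eq_map_inl_of_pairOf {w : List (α ⊕ β)} {u : List α} (h : pairOf w = (u, [])) :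
    w = u.map Sum.inl := by
  induction w generalizing u with
  | nil => simp at h; simp [← h]
  | cons a w ih =>
    cases a with
    | inl a =>
      simp only [pairOf_inl_cons, Prod.mk.injEq] at h
      obtain ⟨rfl, h2⟩ := h
      rw [List.map_cons, ← ih (Prod.ext rfl h2)]
    | inr b => simp at h

theorem map_swap_swap {γ δ : Type*} (w : List (γ ⊕ δ)) : (w.map Sum.swap).map Sum.swap = w := by
  simp [Function.comp_def]

theorem pairOf_map_swap (w : List (α ⊕ β)) : pairOf (w.map Sum.swap) = (pairOf w).swap := by
  induction w with
  | nil => rfl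
  | cons a w ih => cases a <;> simp [ih]

theorem nshift_map_swap (w : List (α ⊕ β)) : nshift (w.map Sum.swap) = nshift w := by
  induction w with
  | nil => rfl
  | cons a w ih =>
    cases w with
    | nil => rfl
    | cons b w =>
      simp only [List.map_cons, nshift] at ih ⊢
      rw [ih]
      cases a <;> cases b <;> simp

/-- A word that synchronizes `(u ++ x, v ++ y)` has a prefix that has consumed one of `u` and `v`
and a part of the other. -/
theorem exists_cut {w : List (α ⊕ β)} {u x : List α} {v y : List β}
    (h : pairOf w = (u ++ x, v ++ y)) :
    ∃ w₁ w₂, w = w₁ ++ w₂ ∧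
      ((∃ v₁, v = (pairOf w₁).2 ++ v₁ ∧ (pairOf w₁).1 = u ∧ pairOf w₂ = (x, v₁ ++ y)) ∨
        (∃ u₁, u = (pairOf w₁).1 ++ u₁ ∧ (pairOf w₁).2 = v ∧ pairOf w₂ = (u₁ ++ x, y))) := by
  induction w generalizing u v with
  | nil =>
    simp at h
    obtain ⟨⟨rfl, rfl⟩, rfl, rfl⟩ := h
    exact ⟨[], [], by simp⟩
  | cons a w ih =>
    cases u with
    | nil => exact ⟨[], a :: w, rfl, .inl ⟨v, by simpa using h⟩⟩
    | cons c u =>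
      cases v with
      | nil => exact ⟨[], a :: w, rfl, .inr ⟨c :: u, by simpa using h⟩⟩
      | cons d v =>
        cases a with
        | inl a =>
          simp only [pairOf_inl_cons, List.cons_append, Prod.mk.injEq, List.cons.injEq] at h
          obtain ⟨⟨rfl, h1⟩, h2⟩ := h
          obtain ⟨w₁, w₂, rfl, h⟩ := ih (u := u) (v := d :: v) (Prod.ext h1 h2)
          exact ⟨Sum.inl a :: w₁, w₂, rfl, by simpa using h⟩
        | inr b =>
          simp only [pairOf_inr_cons, List.cons_append, Prod.mk.injEq, List.cons.injEq] at h
          obtain ⟨h1, rfl, h2⟩ := h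
          obtain ⟨w₁, w₂, rfl, h⟩ := ih (u := c :: u) (v := v) (Prod.ext h1 h2)
          exact ⟨Sum.inr b :: w₁, w₂, rfl, by simpa using h⟩

end PairOf

/-! ### Configurations of an automaton determine residuals -/

section Configurations

variable {α β Q : Type*}

/-- `M` has a run on a synchronization of `(u, v)` from an initial state to `p`. -/
def Reaches (M : NFA (α ⊕ β) Q) (p : Q) (u : List α) (v : List β) : Prop :=
  ∃ q₀ ∈ M.start, ∃ w, pairOf w = (u, v) ∧ Run M q₀ w p

/-- `M` has a run on a synchronization of `(x, y)` from `p` to a final state. -/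
def AcceptsFrom (M : NFA (α ⊕ β) Q) (p : Q) (x : List α) (y : List β) : Prop :=
  ∃ f ∈ M.accept, ∃ w, pairOf w = (x, y) ∧ Run M p w f

theorem mem_relOf_accepts {M : NFA (α ⊕ β) Q} {u : List α} {v : List β} :
    (u, v) ∈ relOf M.accepts ↔ ∃ p ∈ M.start, AcceptsFrom M p u v := by
  simp only [relOf, Set.mem_ofPred_eq, mem_accepts_iff_run, AcceptsFrom]
  tauto

/-- The output word is a concatenation of words read by the blocks in the list; a block is a pair
of states. -/
def ReadsOutput (M : NFA (α ⊕ β) Q) : List (Q × Q) → List β → Prop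
  | [], v => v = []
  | (a, b) :: l, v => ∃ v₁ v₂, v = v₁ ++ v₂ ∧ Run M a (v₁.map Sum.inr) b ∧ ReadsOutput M l v₂

/-- `M` has a run on a synchronization of `(x, y)` from `p` to a final state, if the transitions
over the blocks of output words in the list are for free. -/
def Completes (M : NFA (α ⊕ β) Q) : Q → List (Q × Q) → List α → List β → Prop
  | p, [], x, y => AcceptsFrom M p x y
  | p, (a, b) :: l, x, y =>
    ∃ x₁ x₂, x = x₁ ++ x₂ ∧ Run M p (x₁.map Sum.inl) a ∧ Completes M b l x₂ y

theorem Completes.acceptsFrom {M : NFA (α ⊕ β) Q} {l : List (Q × Q)} {p : Q} {x : List α}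
    {v y : List β} (h : Completes M p l x y) (hv : ReadsOutput M l v) :
    AcceptsFrom M p x (v ++ y) := by
  induction l generalizing p x v with
  | nil =>
    obtain rfl : v = [] := hv
    exact h
  | cons c l ih =>
    obtain ⟨x₁, x₂, rfl, h1, h2⟩ := h
    obtain ⟨v₁, v₂, rfl, h3, h4⟩ := hv
    obtain ⟨f, hf, w, hw, hr⟩ := ih h2 h4
    refine ⟨f, hf, x₁.map Sum.inl ++ (v₁.map Sum.inr ++ w), ?_, ?_⟩
    · simp [pairOf_append, hw]
    · exact run_append.2 ⟨_, h1, run_append.2 ⟨_, h3, hr⟩⟩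

/-- Each maximal block of output letters that `w` spends on `v` is recorded by its first and last
state. Distinct blocks are separated by input letters, so their number is bounded by the shifts. The
last clause strengthens the induction: if `w` starts with an output letter, then the first block
starts at `p` itself and can be prolonged to the left. -/
theorem exists_completes {M : NFA (α ⊕ β) Q} {w : List (α ⊕ β)} {p f : Q} (hf : f ∈ M.accept)
    {x : List α} {v y : List β} (hw : pairOf w = (x, v ++ y)) (hr : Run M p w f) :
    ∃ l, ReadsOutput M l v ∧ Completes M p l x y ∧ l.length ≤ v.length ∧
      l.length ≤ nshift w + 1 ∧
      (∀ b w', w = Sum.inr b :: w' → v ≠ [] → ∃ q l', l = (p, q) :: l' ∧ Completes M q l' x y) := by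
  induction w generalizing p x v with
  | nil =>
    simp only [pairOf_nil, Prod.mk.injEq, List.nil_eq, List.append_eq_nil_iff] at hw
    obtain ⟨rfl, rfl, rfl⟩ := hw
    exact ⟨[], rfl, ⟨f, hf, [], rfl, hr⟩, by simp⟩
  | cons c w ih =>
    rcases eq_or_ne v [] with rfl | hv
    · exact ⟨[], rfl, ⟨f, hf, _, hw, hr⟩, by simp⟩
    obtain ⟨r, hpr, hr⟩ := hr
    cases c with
    | inl a =>
      simp only [pairOf_inl_cons, Prod.mk.injEq] at hw
      obtain ⟨rfl, hw⟩ := hw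
      obtain ⟨l, h1, h2, h3, h4, -⟩ := ih (Prod.ext rfl hw) hr
      refine ⟨l, h1, ?_, h3, ?_, by simp⟩
      · cases l with
        | nil =>
          exact absurd h1 hv
        | cons c l =>
          obtain ⟨x₁, x₂, h5, h6, h7⟩ := h2
          exact ⟨a :: x₁, x₂, by simp [h5], ⟨r, hpr, h6⟩, h7⟩
      · have := nshift_le_append_left [Sum.inl a] w
        simp only [List.singleton_append] at this
        omega
    | inr b =>
      simp only [pairOf_inr_cons, Prod.mk.injEq] at hw
      obtain ⟨rfl, hw⟩ := hw
      obtain ⟨b', v, rfl⟩ := List.exists_cons_of_ne_nil hv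
      simp only [List.cons_append, List.cons.injEq] at hw
      obtain ⟨rfl, hw⟩ := hw
      obtain ⟨l, h1, h2, h3, h4, h5⟩ := ih (Prod.ext rfl hw) hr
      have hmono := nshift_le_append_left [Sum.inr b] w
      simp only [List.singleton_append] at hmono
      -- A new block is opened for `b` if `b` is the last letter of the output part or if an input
      -- letter follows.
      have fresh : l.length ≤ nshift (Sum.inr b :: w) → ∃ l, ReadsOutput M l (b :: v) ∧
          Completes M p l (pairOf w).1 y ∧ l.length ≤ (b :: v).length ∧
          l.length ≤ nshift (Sum.inr b :: w) + 1 ∧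
          (∀ b' w', Sum.inr b :: w = (Sum.inr b' :: w' : List (α ⊕ β)) → b :: v ≠ [] →
            ∃ q l', l = (p, q) :: l' ∧ Completes M q l' (pairOf w).1 y) := fun hlen =>
        ⟨(p, r) :: l, ⟨[b], v, rfl, ⟨r, hpr, rfl⟩, h1⟩, ⟨[], _, rfl, rfl, h2⟩, by simpa using h3,
          by simpa using hlen, fun _ _ _ _ => ⟨r, l, rfl, h2⟩⟩
      rcases eq_or_ne v [] with rfl | hv'
      · have : l.length = 0 := by simpa using h3
        exact fresh (by omega)
      cases w with
      | nil => simp at hw; exact absurd hw.1 hv'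
      | cons c w =>
        cases c with
        | inl a => exact fresh (by simp [nshift] at h4 ⊢; omega)
        | inr d =>
          obtain ⟨q, l', rfl, h6⟩ := h5 d w rfl hv'
          obtain ⟨v₁, v₂, rfl, h7, h8⟩ := h1
          exact ⟨(p, q) :: l', ⟨b :: v₁, v₂, rfl, ⟨r, hpr, h7⟩, h8⟩, ⟨[], _, rfl, rfl, h6⟩,
            by simp at h3 ⊢; omega, by simp [nshift] at h4 ⊢; omega,
            fun _ _ _ _ => ⟨q, l', rfl, h6⟩⟩

/-- The configurations reached by `(u, v)`: a state reached after `u` and a prefix of `v`, and a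
list of blocks that read the rest of `v`. -/
def configs (M : NFA (α ⊕ β) Q) (k : ℕ) (u : List α) (v : List β) : Set (Q × List (Q × Q)) :=
  {κ | κ.2.length ≤ 2 * k ∧ ∃ v₀ v₁, v = v₀ ++ v₁ ∧ Reaches M κ.1 u v₀ ∧ ReadsOutput M κ.2 v₁}

theorem mem_relOf_of_mem_configs {M : NFA (α ⊕ β) Q} {k : ℕ} {u x : List α} {v y : List β}
    {κ : Q × List (Q × Q)} (h : κ ∈ configs M k u v) (hc : Completes M κ.1 κ.2 x y) :
    (u ++ x, v ++ y) ∈ relOf M.accepts := by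
  obtain ⟨-, v₀, v₁, rfl, ⟨q₀, hq₀, w, hw, hr⟩, h1⟩ := h
  obtain ⟨f, hf, w', hw', hr'⟩ := hc.acceptsFrom h1
  exact mem_relOf_accepts.2 ⟨q₀, hq₀, f, hf, w ++ w', by simp [pairOf_append, hw, hw'],
    run_append.2 ⟨_, hr, hr'⟩⟩

/-- If the lag at the cut is at least `k`, then few shifts follow and `v₁` is read in few blocks. If
it is smaller, then `v₁` itself has length less than `k`, because `(pairOf w₁).2 ++ v₁` is no longer
than the input read. -/
theorem exists_mem_configs {M : NFA (α ⊕ β) Q} {k : ℕ} (hM : FewShiftsAfterLag M k)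
    {q₀ f : Q} (hq₀ : q₀ ∈ M.start) (hf : f ∈ M.accept) {w₁ w₂ : List (α ⊕ β)}
    (hr : Run M q₀ (w₁ ++ w₂) f) {x : List α} {v₁ y : List β} (hw₂ : pairOf w₂ = (x, v₁ ++ y))
    (hlen : ((pairOf w₁).2 ++ v₁).length ≤ (pairOf w₁).1.length) :
    ∃ κ ∈ configs M k (pairOf w₁).1 ((pairOf w₁).2 ++ v₁), Completes M κ.1 κ.2 x y := by
  obtain ⟨p, h1, h2⟩ := run_append.1 hr
  obtain ⟨l, h3, h4, h5, h6, -⟩ := exists_completes hf hw₂ h2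
  refine ⟨(p, l), ⟨?_, _, v₁, rfl, ⟨q₀, hq₀, w₁, rfl, h1⟩, h3⟩, h4⟩
  have hg := gain_eq_pairOf w₁
  rw [List.length_append] at hlen
  by_cases hk : k ≤ (gain w₁).natAbs
  · have := hM hq₀ hf h1 h2 hk
    simp only; omega
  · simp only; omega

/-- The automaton with the roles of input and output exchanged. -/
def swapNFA (M : NFA (α ⊕ β) Q) : NFA (β ⊕ α) Q where
  step q x := M.step q x.swap
  start := M.start
  accept := M.accept

theorem run_swapNFA {M : NFA (α ⊕ β) Q} {p q : Q} {w : List (β ⊕ α)} :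
    Run (swapNFA M) p w q ↔ Run M p (w.map Sum.swap) q := by
  induction w generalizing p with
  | nil => rfl
  | cons a w ih => simp only [Run, List.map_cons, ih]; rfl

theorem mem_relOf_swapNFA {M : NFA (α ⊕ β) Q} {u : List α} {v : List β} :
    (v, u) ∈ relOf (swapNFA M).accepts ↔ (u, v) ∈ relOf M.accepts := by
  have : ∀ p, AcceptsFrom (swapNFA M) p v u ↔ AcceptsFrom M p u v := by
    intro p
    constructor
    · rintro ⟨f, hf, w, hw, hr⟩
      exact ⟨f, hf, w.map Sum.swap, by rw [pairOf_map_swap, hw]; rfl, run_swapNFA.1 hr⟩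
    · rintro ⟨f, hf, w, hw, hr⟩
      exact ⟨f, hf, w.map Sum.swap, by rw [pairOf_map_swap, hw]; rfl,
        run_swapNFA.2 (by rwa [map_swap_swap])⟩
  simp only [mem_relOf_accepts, this]
  rfl

theorem FewShiftsAfterLag.swap {M : NFA (α ⊕ β) Q} {k : ℕ} (h : FewShiftsAfterLag M k) :
    FewShiftsAfterLag (swapNFA M) k := by
  intro q₀ p f v w hq₀ hf hv hw hk
  rw [← nshift_map_swap]
  refine h hq₀ hf (run_swapNFA.1 hv) (run_swapNFA.1 hw) ?_
  rw [gain_eq_pairOf] at hk ⊢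
  rw [pairOf_map_swap]
  simp only [Prod.fst_swap, Prod.snd_swap]
  omega

theorem mem_relOf_iff_of_le {M : NFA (α ⊕ β) Q} {k : ℕ} (hM : FewShiftsAfterLag M k)
    {u x : List α} {v : List β} (hlen : v.length ≤ u.length) :
    (u ++ x, v) ∈ relOf M.accepts ↔ ∃ κ ∈ configs M k u v, Completes M κ.1 κ.2 x [] := by
  constructor
  · intro h
    obtain ⟨q₀, hq₀, f, hf, w, hw, hr⟩ := mem_relOf_accepts.1 h
    rw [← List.append_nil v] at hw
    obtain ⟨w₁, w₂, rfl, ⟨v₁, rfl, rfl, h2⟩ | ⟨u₁, rfl, rfl, h2⟩⟩ := exists_cut hw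
    · exact exists_mem_configs hM hq₀ hf hr h2 hlen
    -- All output has been consumed and only input remains, so the cut can be moved to the end of
    -- `u`, with no block left over.
    · rw [eq_map_inl_of_pairOf h2, List.map_append, ← List.append_assoc] at hr
      have := exists_mem_configs hM hq₀ hf hr (x := x) (v₁ := []) (y := []) (by simp)
        (by simpa [pairOf_append] using hlen)
      simpa [pairOf_append] using this
  · rintro ⟨κ, h1, h2⟩
    simpa using mem_relOf_of_mem_configs h1 h2

/-- A run on a synchronization of `(u ++ x, v ++ y)` finishes `u` or `v` first. In the second case
the automaton with exchanged tapes provides the configuration. -/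
theorem mem_relOf_iff_of_eq {M : NFA (α ⊕ β) Q} {k : ℕ} (hM : FewShiftsAfterLag M k)
    {u x : List α} {v y : List β} (hlen : u.length = v.length) :
    (u ++ x, v ++ y) ∈ relOf M.accepts ↔ (∃ κ ∈ configs M k u v, Completes M κ.1 κ.2 x y) ∨
      (∃ κ ∈ configs (swapNFA M) k v u, Completes (swapNFA M) κ.1 κ.2 y x) := by
  constructor
  · intro h
    obtain ⟨q₀, hq₀, f, hf, w, hw, hr⟩ := mem_relOf_accepts.1 h
    obtain ⟨w₁, w₂, rfl, ⟨v₁, rfl, rfl, h2⟩ | ⟨u₁, rfl, rfl, h2⟩⟩ := exists_cut hw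
    · exact .inl (exists_mem_configs hM hq₀ hf hr h2 hlen.ge)
    · right
      have hr' : Run (swapNFA M) q₀ (w₁.map Sum.swap ++ w₂.map Sum.swap) f := by
        rw [run_swapNFA, ← List.map_append, map_swap_swap]
        exact hr
      have := exists_mem_configs hM.swap hq₀ hf hr' (x := y) (v₁ := u₁) (y := x)
        (by rw [pairOf_map_swap, h2]; rfl) (by simpa [pairOf_map_swap] using hlen.le)
      simpa [pairOf_map_swap] using this
  · rintro (⟨κ, h1, h2⟩ | ⟨κ, h1, h2⟩)
    · exact mem_relOf_of_mem_configs h1 h2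
    · exact mem_relOf_swapNFA.1 (mem_relOf_of_mem_configs h1 h2)

/-- Configurations with lists of blocks of length at most `n`, as a type that is visibly finite. -/
abbrev ConfigCode (Q : Type*) (n : ℕ) := Q × (Fin n → Option (Q × Q))

/-- The set of configurations of a pair of words, as a set of `ConfigCode`s. -/
def configCodes (M : NFA (α ⊕ β) Q) (k : ℕ) (u : List α) (v : List β) :
    Set (ConfigCode Q (2 * k)) :=
  (fun κ : Q × List (Q × Q) => (κ.1, fun i : Fin (2 * k) => κ.2[(i : ℕ)]?)) '' configs M k u v

theorem configs_eq_of_configCodes_eq {M : NFA (α ⊕ β) Q} {k : ℕ} {u u' : List α} {v v' : List β}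
    (h : configCodes M k u v = configCodes M k u' v') : configs M k u v = configs M k u' v' := by
  have hinj : Set.InjOn (fun κ : Q × List (Q × Q) =>
      (κ.1, fun i : Fin (2 * k) => κ.2[(i : ℕ)]?)) {κ | κ.2.length ≤ 2 * k} := by
    rintro ⟨p, l⟩ hl ⟨p', l'⟩ hl' heq
    simp only [Set.mem_ofPred_eq] at hl hl'
    simp only [Prod.mk.injEq] at heq
    refine Prod.ext heq.1 (List.ext_getElem? fun i => ?_)
    by_cases hi : i < 2 * k
    · exact congrFun heq.2 ⟨i, hi⟩
    · show l[i]? = l'[i]?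
      rw [List.getElem?_eq_none (by omega), List.getElem?_eq_none (by omega)]
  exact (hinj.image_eq_image_iff (fun κ h => h.1) fun κ h => h.1).1 h

/-- Pairs of words have finitely many residuals, if few shifts follow large lags. -/
def configResidualCode (M : NFA (α ⊕ β) Q) (k : ℕ) (hM : FewShiftsAfterLag M k) :
    ResidualCode (relOf M.accepts)
      (Set (ConfigCode Q (2 * k)) × Set (ConfigCode Q (2 * k))) where
  code u v := (configCodes M k u v, configCodes (swapNFA M) k v u)
  res_eq hl hl' h := by
    simp only [Prod.mk.injEq] at h
    have h1 := configs_eq_of_configCodes_eq h.1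
    have h2 := configs_eq_of_configCodes_eq h.2
    ext ⟨x, y⟩
    simp only [res, Set.mem_ofPred_eq, mem_relOf_iff_of_eq hM hl, mem_relOf_iff_of_eq hM hl', h1, h2]
  resIn_eq hl hl' h := by
    simp only [Prod.mk.injEq] at h
    have h1 := configs_eq_of_configCodes_eq h.1
    ext x
    simp only [resIn, Set.mem_ofPred_eq, mem_relOf_iff_of_le hM hl, mem_relOf_iff_of_le hM hl', h1]
  resOut_eq hl hl' h := by
    simp only [Prod.mk.injEq] at h
    have h2 := configs_eq_of_configCodes_eq h.2
    ext x
    simp only [resOut, Set.mem_ofPred_eq, ← mem_relOf_swapNFA (M := M),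
      mem_relOf_iff_of_le hM.swap hl, mem_relOf_iff_of_le hM.swap hl', h2]

end Configurations

/-! ### Short representatives for right congruences of finite index -/

section ShortWords

variable {γ X Y : Type*}

theorem exists_factor_of_card_le [Fintype Y] {f : List γ → X} {c : List γ → Y}
    (hc : ∀ w w', c w = c w' → f w = f w') {w : List γ} (hw : Fintype.card Y ≤ w.length) :
    ∃ a b d, w = a ++ b ++ d ∧ b ≠ [] ∧ f (a ++ b) = f a := by
  obtain ⟨i, j, hij, h⟩ := Fintype.exists_ne_map_eq_of_card_lt
    (fun i : Fin (w.length + 1) => c (w.take i)) (by simp; omega)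
  wlog hlt : i < j generalizing i j
  · exact this j i hij.symm h.symm (lt_of_le_of_ne (not_lt.1 hlt) hij.symm)
  have hlt' : (i : ℕ) < j := hlt
  have hj : (j : ℕ) ≤ w.length := Nat.lt_succ_iff.1 j.2
  have htake : w.take i ++ (w.drop i).take (j - i) = w.take j := by
    rw [← List.take_add]; congr 1; omega
  refine ⟨w.take i, (w.drop i).take (j - i), w.drop j, ?_, ?_, ?_⟩
  · rw [htake, List.take_append_drop]
  · intro h0
    have := congrArg List.length h0
    simp at this
    omega
  · rw [htake]
    exact (hc _ _ h).symm

/-- Here `f` induces a right congruence, and the code `c` into a finite type shows that it has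
finite index. Factors between two prefixes of equal class are deleted. -/
theorem exists_short [Fintype Y] {f : List γ → X} {c : List γ → Y}
    (hf : ∀ w w' t, f w = f w' → f (w ++ t) = f (w' ++ t))
    (hc : ∀ w w', c w = c w' → f w = f w') (w : List γ) :
    ∃ w', f w' = f w ∧ w'.length ≤ Fintype.card Y := by
  induction hl : w.length using Nat.strong_induction_on generalizing w with
  | _ l ih =>
    by_cases hw : Fintype.card Y ≤ w.length
    · obtain ⟨a, b, d, rfl, hb, hab⟩ := exists_factor_of_card_le hc hw
      have := List.length_pos_iff.2 hb
      obtain ⟨w', h1, h2⟩ := ih (a ++ d).length (by rw [← hl]; simp; omega) _ rfl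
      exact ⟨w', h1.trans (hf _ _ d hab).symm, h2⟩
    · exact ⟨w, rfl, (not_le.1 hw).le⟩

/-- If every word of some fixed length has a good nonempty prefix, then so has every word whose
length is at least the number of classes. -/
theorem exists_good_prefix [Fintype Y] {f : List γ → X} {c : List γ → Y}
    (hf : ∀ w w' t, f w = f w' → f (w ++ t) = f (w' ++ t))
    (hc : ∀ w w', c w = c w' → f w = f w') {Good : List γ → Prop}
    (hgood : ∀ z z', z' ≠ [] → f z = f z' → Good z → Good z') {K : ℕ}
    (hK : ∀ z : List γ, z.length = K → ∃ z', z' ≠ [] ∧ z' <+: z ∧ Good z')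
    {z : List γ} (hz : Fintype.card Y ≤ z.length) : ∃ z', z' ≠ [] ∧ z' <+: z ∧ Good z' := by
  classical
  have hex : ∃ n, ∀ z : List γ, n ≤ z.length → ∃ z', z' ≠ [] ∧ z' <+: z ∧ Good z' := by
    refine ⟨K, fun z hz => ?_⟩
    obtain ⟨z', h1, h2, h3⟩ := hK (z.take K) (by simpa using hz)
    exact ⟨z', h1, h2.trans (List.take_prefix _ _), h3⟩
  by_cases hle : Nat.find hex ≤ Fintype.card Y
  · exact Nat.find_spec hex z (hle.trans hz)
  exfalso
  have hmin := Nat.find_min hex (m := Nat.find hex - 1) (by omega)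
  push Not at hmin
  obtain ⟨z, hz', hbad⟩ := hmin
  obtain ⟨a, b, d, rfl, hb, hab⟩ := exists_factor_of_card_le hc (w := z) (by omega)
  have := List.length_pos_iff.2 hb
  -- With `b` repeated, a longest bad word exceeds the threshold and gets a good prefix. If this
  -- prefix reaches beyond `a ++ b`, then deleting one copy of `b` from it gives a prefix of the
  -- original word in the same class.
  obtain ⟨z', h1, h2, h3⟩ := Nat.find_spec hex ((a ++ b) ++ (b ++ d)) (by
    simp only [List.length_append] at hz' ⊢; omega)
  rcases le_total z'.length (a ++ b).length with hl | hl
  · exact hbad z' h1 ((List.prefix_of_prefix_length_le h2 (List.prefix_append _ _) hl).trans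
      (List.prefix_append _ _)) h3
  · obtain ⟨s, rfl⟩ := List.prefix_of_prefix_length_le (List.prefix_append _ _) h2 hl
    rcases eq_or_ne s [] with rfl | hs
    · exact hbad _ h1 (by simp) h3
    · refine hbad (a ++ s) (by simp [hs]) ?_ (hgood _ _ (by simp [hs]) (hf _ _ s hab) h3)
      rw [List.append_assoc, List.prefix_append_right_inj]
      exact (List.prefix_append_right_inj _).1 h2

end ShortWords

/-! ### The uniformization game and its finite abstraction -/

section Game

variable {α β X : Type*} {R : Set (List α × List β)}

/-- After the pair `(u, v)` has been committed to, the input continuation `z` has an image. -/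
def Dom (R : Set (List α × List β)) (u : List α) (v : List β) (z : List α) : Prop :=
  ∃ y, (u ++ z, v ++ y) ∈ R

/-- After the pair `(u, v)`, all inputs extending `x` have images that are not longer than `x`. -/
def Covered (R : Set (List α × List β)) (u : List α) (v : List β) (x : List α) : Prop :=
  ∀ t, Dom R u v (x ++ t) → ∃ y, y.length ≤ x.length ∧ (u ++ (x ++ t), v ++ y) ∈ R

/-- After the pair `(u, v)` with pending input `x ++ z`, the output `y` for `x` does not exclude
any input. -/
def Safe (R : Set (List α × List β)) (u : List α) (v : List β) (x : List α) (y : List β)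
    (z : List α) : Prop :=
  ∀ t, Dom R u v (x ++ (z ++ t)) → Dom R (u ++ x) (v ++ y) (z ++ t)

/-- The information on a pending input that determines how the game continues. -/
def profile (R : Set (List α × List β)) (z : List α) (u : List α) (v : List β) :
    Set (Set (List α × List β)) × Set (Set (List α)) :=
  ({S | u.length = v.length ∧ ∃ y, y.length = z.length ∧ S = res R (u ++ z) (v ++ y)},
    {S | u.length = v.length ∧ ∃ y, y.length ≤ z.length ∧ S = resIn R (u ++ z) (v ++ y)})

theorem mem_iff_of_res_eq {u u' : List α} {v v' : List β} (h : res R u v = res R u' v')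
    (x : List α) (y : List β) : (u ++ x, v ++ y) ∈ R ↔ (u' ++ x, v' ++ y) ∈ R :=
  Set.ext_iff.1 h (x, y)

theorem mem_iff_of_resIn_eq {u u' : List α} {v v' : List β} (h : resIn R u v = resIn R u' v')
    (x : List α) : (u ++ x, v) ∈ R ↔ (u' ++ x, v') ∈ R :=
  Set.ext_iff.1 h x

theorem res_append_congr {u u' : List α} {v v' : List β} (h : res R u v = res R u' v')
    (x : List α) (y : List β) : res R (u ++ x) (v ++ y) = res R (u' ++ x) (v' ++ y) := by
  ext ⟨s, t⟩
  simpa [res] using mem_iff_of_res_eq h (x ++ s) (y ++ t)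

theorem resIn_append_congr_of_res_eq {u u' : List α} {v v' : List β}
    (h : res R u v = res R u' v') (x : List α) (y : List β) :
    resIn R (u ++ x) (v ++ y) = resIn R (u' ++ x) (v' ++ y) := by
  ext s
  simpa [resIn] using mem_iff_of_res_eq h (x ++ s) y

theorem resIn_append_congr {u u' : List α} {v v' : List β} (h : resIn R u v = resIn R u' v')
    (x : List α) : resIn R (u ++ x) v = resIn R (u' ++ x) v' := by
  ext s
  simpa [resIn] using mem_iff_of_resIn_eq h (x ++ s)

theorem exists_res_eq_of_profile_eq {z z' : List α} (h : profile R z = profile R z')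
    {u : List α} {v : List β} (huv : u.length = v.length) {y : List β}
    (hy : y.length = z.length) :
    ∃ y', y'.length = z'.length ∧ res R (u ++ z) (v ++ y) = res R (u ++ z') (v ++ y') := by
  have h1 : res R (u ++ z) (v ++ y) ∈ (profile R z u v).1 := ⟨huv, y, hy, rfl⟩
  rw [h] at h1
  exact h1.2

theorem exists_resIn_eq_of_profile_eq {z z' : List α} (h : profile R z = profile R z')
    {u : List α} {v : List β} (huv : u.length = v.length) {y : List β}
    (hy : y.length ≤ z.length) :
    ∃ y', y'.length ≤ z'.length ∧ resIn R (u ++ z) (v ++ y) = resIn R (u ++ z') (v ++ y') := by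
  have h1 : resIn R (u ++ z) (v ++ y) ∈ (profile R z u v).2 := ⟨huv, y, hy, rfl⟩
  rw [h] at h1
  exact h1.2

/-- An output for `z ++ t` is cut at `z.length`: the first part is exchanged by means of the
profile, and the rest follows by congruence of residuals. If the output ends before `z` does, the
one-sided residuals in the second component take over. -/
theorem profile_append_congr {z z' : List α} (h : profile R z = profile R z') (t : List α) :
    profile R (z ++ t) = profile R (z' ++ t) := by
  have main : ∀ z z' : List α, profile R z = profile R z' → ∀ u v,
      (profile R (z ++ t) u v).1 ⊆ (profile R (z' ++ t) u v).1 ∧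
        (profile R (z ++ t) u v).2 ⊆ (profile R (z' ++ t) u v).2 := by
    intro z z' h u v
    constructor
    · rintro S ⟨huv, y, hy, rfl⟩
      rw [List.length_append] at hy
      obtain ⟨y', h1, h2⟩ := exists_res_eq_of_profile_eq h huv (y := y.take z.length)
        (by simp; omega)
      refine ⟨huv, y' ++ y.drop z.length, by simp; omega, ?_⟩
      simpa using res_append_congr h2 t (y.drop z.length)
    · rintro S ⟨huv, y, hy, rfl⟩
      rw [List.length_append] at hy
      rcases le_total y.length z.length with hle | hle
      · obtain ⟨y', h1, h2⟩ := exists_resIn_eq_of_profile_eq h huv hle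
        exact ⟨huv, y', by simp; omega, by simpa using resIn_append_congr h2 t⟩
      · obtain ⟨y', h1, h2⟩ := exists_res_eq_of_profile_eq h huv (y := y.take z.length)
          (by simp; omega)
        refine ⟨huv, y' ++ y.drop z.length, by simp; omega, ?_⟩
        simpa using resIn_append_congr_of_res_eq h2 t (y.drop z.length)
  funext u v
  exact Prod.ext ((main z z' h u v).1.antisymm (main z' z h.symm u v).1)
    ((main z z' h u v).2.antisymm (main z' z h.symm u v).2)

theorem dom_iff_of_res_eq {u u' : List α} {v v' : List β} (h : res R u v = res R u' v')
    (z : List α) : Dom R u v z ↔ Dom R u' v' z := by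
  simp only [Dom, mem_iff_of_res_eq h]

theorem Dom.of_profile_eq {z z' : List α} (h : profile R z = profile R z') {u : List α}
    {v : List β} (huv : u.length = v.length) (hd : Dom R u v z) : Dom R u v z' := by
  obtain ⟨y, hy⟩ := hd
  rcases le_total y.length z.length with hle | hle
  · obtain ⟨y', h1, h2⟩ := exists_resIn_eq_of_profile_eq h huv hle
    exact ⟨y', by simpa using (mem_iff_of_resIn_eq h2 []).1 (by simpa using hy)⟩
  · obtain ⟨y', h1, h2⟩ := exists_res_eq_of_profile_eq h huv (y := y.take z.length) (by simp; omega)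
    have := (mem_iff_of_res_eq h2 [] (y.drop z.length)).1 (by simpa using hy)
    exact ⟨_, by simpa using this⟩

theorem Covered.of_res_eq {u u' : List α} {v v' : List β} (h : res R u v = res R u' v')
    {x : List α} (hc : Covered R u v x) : Covered R u' v' x := by
  intro t ht
  obtain ⟨y, h1, h2⟩ := hc t ((dom_iff_of_res_eq h _).2 ht)
  exact ⟨y, h1, (mem_iff_of_res_eq h _ _).1 h2⟩

theorem Covered.of_profile_eq {x x' : List α} (h : profile R x = profile R x') {u : List α}
    {v : List β} (huv : u.length = v.length) (hc : Covered R u v x) : Covered R u v x' := by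
  intro t ht
  obtain ⟨y, h1, h2⟩ := hc t (ht.of_profile_eq (profile_append_congr h.symm t) huv)
  obtain ⟨y', h3, h4⟩ := exists_resIn_eq_of_profile_eq h huv h1
  exact ⟨y', h3, by simpa using (mem_iff_of_resIn_eq h4 t).1 (by simpa using h2)⟩

/-- The position `(u, v)` with pending input `x` is won when the input has continued with `z`, if
all positions in `W` are won. -/
def Good (R : Set (List α × List β)) (W : Set (List α × List β × List α)) (u : List α)
    (v : List β) (x z : List α) : Prop :=
  Covered R u v (x ++ z) ∨ ∃ y, y.length = x.length ∧ Safe R u v x y z ∧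
    ∃ u' v', (u', v', z) ∈ W ∧ res R (u ++ x) (v ++ y) = res R u' v'

/-- A set of positions that is winning, with lookahead bounded by `2 * K`. -/
structure Closed (R : Set (List α × List β)) (W : Set (List α × List β × List α)) (K : ℕ) :
    Prop where
  init : ([], [], []) ∈ W
  length_eq : ∀ {u v x}, (u, v, x) ∈ W → u.length = v.length
  good : ∀ {u v x}, (u, v, x) ∈ W → ∀ z : List α, z.length = K →
    ∃ z', z' ≠ [] ∧ z' <+: z ∧ Good R W u v x z'

/-- The saturation of a set of positions. -/
def saturation (R : Set (List α × List β)) (W : Set (List α × List β × List α)) :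
    Set (List α × List β × List α) :=
  {p | p.1.length = p.2.1.length ∧ ∃ u v x, (u, v, x) ∈ W ∧ u.length = v.length ∧
    res R p.1 p.2.1 = res R u v ∧ profile R p.2.2 = profile R x}

theorem Safe.of_eq {u u' : List α} {v v' : List β} (h : res R u v = res R u' v') {x x' : List α}
    (huv : u.length = v.length) (huv' : u'.length = v'.length)
    {y y' : List β} (hy : y.length = x.length) (hxy : res R (u ++ x) (v ++ y) = res R (u' ++ x') (v' ++ y'))
    {z z' : List α} (hz : profile R z = profile R z')
    (hxz : profile R (x ++ z) = profile R (x' ++ z')) (hs : Safe R u v x y z) :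
    Safe R u' v' x' y' z' := by
  intro t ht
  rw [← dom_iff_of_res_eq hxy]
  refine Dom.of_profile_eq (profile_append_congr hz t) (by simp; omega) (hs t ?_)
  rw [dom_iff_of_res_eq h, ← List.append_assoc]
  refine Dom.of_profile_eq (profile_append_congr hxz.symm t) huv' ?_
  rwa [List.append_assoc]

/-- A move depends on `u, v` only through their residual, and on `x` and `z` only through the
profiles of `x`, `z` and `x ++ z`. The answer `y` is exchanged for one that leads to the same
residual. -/
theorem Good.to_saturation {W : Set (List α × List β × List α)}
    (hlen : ∀ {u v x}, (u, v, x) ∈ W → u.length = v.length) {u u' : List α} {v v' : List β}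
    (h : res R u v = res R u' v') (huv : u.length = v.length) (huv' : u'.length = v'.length)
    {x x' : List α} (hx : profile R x = profile R x') {z z' : List α}
    (hz : profile R z = profile R z') (hxz : profile R (x ++ z) = profile R (x' ++ z'))
    (hg : Good R W u v x z) : Good R (saturation R W) u' v' x' z' := by
  rcases hg with hc | ⟨y, hy, hs, u₁, v₁, hW, hres⟩
  · exact .inl ((hc.of_profile_eq hxz huv).of_res_eq h)
  · obtain ⟨y', hy', h1⟩ := exists_res_eq_of_profile_eq hx huv hy
    have h2 := h1.trans (res_append_congr h x' y')
    exact .inr ⟨y', hy', hs.of_eq h huv huv' hy h2 hz hxz, u₁, v₁,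
      ⟨hlen hW, u₁, v₁, z, hW, hlen hW, rfl, hz.symm⟩, h2.symm.trans hres⟩

theorem saturation_saturation (W : Set (List α × List β × List α)) :
    saturation R (saturation R W) = saturation R W := by
  ext ⟨u, v, x⟩
  constructor
  · rintro ⟨h1, u', v', x', ⟨h2, u'', v'', x'', h3, h4, h5, h6⟩, -, h7, h8⟩
    exact ⟨h1, u'', v'', x'', h3, h4, h7.trans h5, h8.trans h6⟩
  · exact fun h => ⟨h.1, u, v, x, h, h.1, rfl, rfl⟩

theorem Closed.to_saturation {W : Set (List α × List β × List α)} {K : ℕ} (hW : Closed R W K) :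
    Closed R (saturation R W) K where
  init := ⟨rfl, [], [], [], hW.init, rfl, rfl, rfl⟩
  length_eq h := h.1
  good := by
    rintro u v x ⟨huv, u', v', x', h1, h2, h3, h4⟩ z hz
    obtain ⟨z', h5, h6, h7⟩ := hW.good h1 z hz
    exact ⟨z', h5, h6, h7.to_saturation hW.length_eq h3.symm h2 huv h4.symm rfl
      (profile_append_congr h4.symm z')⟩

/-- A code of profiles. -/
def profileCode (e : ResidualCode R X) (z : List α) : Set (X × X) × Set (X × X) :=
  ({p | ∃ u v y, u.length = v.length ∧ y.length = z.length ∧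
      p = (e.code u v, e.code (u ++ z) (v ++ y))},
    {p | ∃ u v y, u.length = v.length ∧ y.length ≤ z.length ∧
      p = (e.code u v, e.code (u ++ z) (v ++ y))})

/-- A profile is a function of infinitely many pairs `(u, v)`, whereas its code is a set of pairs of
codes. Nothing is lost: a pair `(u', v')` with the same code as `(u, v)` has the same residual, so
the answer found for `(u', v')` also serves `(u, v)`. -/
theorem profile_eq_of_profileCode_eq (e : ResidualCode R X) {z z' : List α}
    (h : profileCode e z = profileCode e z') : profile R z = profile R z' := by
  have main : ∀ z z' : List α, profileCode e z = profileCode e z' → ∀ u v,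
      (profile R z u v).1 ⊆ (profile R z' u v).1 ∧
        (profile R z u v).2 ⊆ (profile R z' u v).2 := by
    intro z z' h u v
    constructor
    · rintro S ⟨huv, y, hy, rfl⟩
      have h1 : (e.code u v, e.code (u ++ z) (v ++ y)) ∈ (profileCode e z).1 :=
        ⟨u, v, y, huv, hy, rfl⟩
      rw [h] at h1
      obtain ⟨u', v', y', huv', hy', h2⟩ := h1
      simp only [Prod.mk.injEq] at h2
      refine ⟨huv, y', hy', ?_⟩
      rw [e.res_eq (by simp; omega) (by simp; omega) h2.2]
      exact (res_append_congr (e.res_eq huv huv' h2.1) _ _).symm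
    · rintro S ⟨huv, y, hy, rfl⟩
      have h1 : (e.code u v, e.code (u ++ z) (v ++ y)) ∈ (profileCode e z).2 :=
        ⟨u, v, y, huv, hy, rfl⟩
      rw [h] at h1
      obtain ⟨u', v', y', huv', hy', h2⟩ := h1
      simp only [Prod.mk.injEq] at h2
      refine ⟨huv, y', hy', ?_⟩
      rw [e.resIn_eq (by simp; omega) (by simp; omega) h2.2]
      exact (resIn_append_congr_of_res_eq (e.res_eq huv huv' h2.1) _ _).symm
  funext u v
  exact Prod.ext ((main z z' h u v).1.antisymm (main z' z h.symm u v).1)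
    ((main z z' h u v).2.antisymm (main z' z h.symm u v).2)

/-- Codes of pairs of profiles. -/
abbrev ProfilePairCode (X : Type*) :=
  (Set (X × X) × Set (X × X)) × (Set (X × X) × Set (X × X))

/-- In a saturated set, goodness of `z` depends only on the profiles of `x ++ z` and `z`. This is a
right congruence of finite index, so `exists_good_prefix` bounds the lookahead. -/
theorem Closed.bound [Fintype (ProfilePairCode X)] (e : ResidualCode R X)
    {W : Set (List α × List β × List α)} {K : ℕ}
    (hW : Closed R (saturation R W) K) {B : ℕ} (hB : Fintype.card (ProfilePairCode X) ≤ B) :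
    Closed R (saturation R W) B where
  init := hW.init
  length_eq := hW.length_eq
  good {u v x} h z hz := by
    refine exists_good_prefix (f := fun z => (profile R (x ++ z), profile R z))
      (c := fun z => (profileCode e (x ++ z), profileCode e z)) ?_ ?_ ?_ (hW.good h)
      (by omega : Fintype.card (ProfilePairCode X) ≤ z.length)
    · intro w w' t hw
      simp only [Prod.mk.injEq] at hw ⊢
      rw [← List.append_assoc, ← List.append_assoc]
      exact ⟨profile_append_congr hw.1 t, profile_append_congr hw.2 t⟩
    · intro w w' hw
      simp only [Prod.mk.injEq] at hw ⊢
      exact ⟨profile_eq_of_profileCode_eq e hw.1, profile_eq_of_profileCode_eq e hw.2⟩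
    · intro z z' _ hz hg
      simp only [Prod.mk.injEq] at hz
      have := hg.to_saturation hW.length_eq rfl h.1 h.1 rfl hz.2 hz.1
      rwa [saturation_saturation] at this

/-- Pairs of words of equal length are words over `α × β`, on which equality of residuals is a right
congruence. -/
theorem exists_short_res_eq [Fintype X] (e : ResidualCode R X) {u : List α} {v : List β}
    (huv : u.length = v.length) : ∃ u' v', u'.length = v'.length ∧ u'.length ≤ Fintype.card X ∧
      res R u v = res R u' v' := by
  obtain ⟨w, h1, h2⟩ := exists_short (γ := α × β)
    (f := fun w => res R (w.map Prod.fst) (w.map Prod.snd))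
    (c := fun w => e.code (w.map Prod.fst) (w.map Prod.snd))
    (fun w w' t h => by simpa using res_append_congr h _ _)
    (fun w w' h => e.res_eq (by simp) (by simp) h) (u.zip v)
  refine ⟨w.map Prod.fst, w.map Prod.snd, by simp, by simpa using h2, ?_⟩
  rw [h1]
  simp [List.map_fst_zip, List.map_snd_zip, huv]

/-- A winning set of positions can be replaced by one with short words. -/
theorem Closed.exists_bounded [Fintype X] [Fintype (ProfilePairCode X)] (e : ResidualCode R X)
    {W : Set (List α × List β × List α)} {K : ℕ} (hW : Closed R W K) {B : ℕ}
    (hX : Fintype.card X ≤ B) (hB : Fintype.card (ProfilePairCode X) ≤ B) :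
    ∃ W', Closed R W' B ∧ ∀ u v x, (u, v, x) ∈ W' → u.length ≤ B ∧ x.length ≤ B := by
  have hS := hW.to_saturation.bound e hB
  -- The short positions of the saturation suffice: a target `(u', v')` may be replaced by a short
  -- pair with the same residual, and the new pending input is a prefix of the lookahead `z` of
  -- length `B`.
  refine ⟨{p | p ∈ saturation R W ∧ p.1.length ≤ B ∧ p.2.2.length ≤ B},
    ⟨⟨hS.init, by simp⟩, fun h => hS.length_eq h.1, ?_⟩, fun u v x h => h.2⟩
  rintro u v x ⟨h, -, -⟩ z hz
  obtain ⟨z', h1, h2, hc | ⟨y, hy, hs, u', v', h3, h4⟩⟩ := hS.good h z hz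
  · exact ⟨z', h1, h2, .inl hc⟩
  · obtain ⟨u₁, v₁, h5, h6, h7⟩ := exists_short_res_eq e h3.1
    refine ⟨z', h1, h2, .inr ⟨y, hy, hs, u₁, v₁, ⟨?_, h6.trans hX, ?_⟩, h4.trans h7⟩⟩
    · obtain ⟨-, u'', v'', x'', h8, h9, h10, h11⟩ := h3
      exact ⟨h5, u'', v'', x'', h8, h9, h7.symm.trans h10, h11⟩
    · have := h2.length_le
      simp only; omega

end Game

/-! ### Shifts of prefixes -/

section Shifts

variable {α β : Type*}

theorem nshift_append_singleton_le (w : List (α ⊕ β)) (a : α ⊕ β) :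
    nshift (w ++ [a]) ≤ nshift w + 1 := by
  induction w with
  | nil => simp [nshift]
  | cons b w ih =>
    cases w with
    | nil => simp only [List.singleton_append, nshift]; split_ifs <;> omega
    | cons c w => simp only [List.cons_append, nshift] at ih ⊢; omega

theorem exists_prefix_nshift_eq (w : List (α ⊕ β)) {m : ℕ} (h : m ≤ nshift w) :
    ∃ t, t <+: w ∧ nshift t = m := by
  induction w using List.reverseRecOn with
  | nil => exact ⟨[], List.prefix_rfl, by simp [nshift] at h ⊢; omega⟩
  | append_singleton w a ih =>
    by_cases hm : m ≤ nshift w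
    · obtain ⟨t, h1, h2⟩ := ih hm
      exact ⟨t, h1.trans (List.prefix_append _ _), h2⟩
    · have := nshift_append_singleton_le w a
      exact ⟨_, List.prefix_rfl, by omega⟩

theorem prefix_append_cases {γ : Type*} {t v w : List γ} (h : t <+: v ++ w) :
    t <+: v ∨ ∃ s, t = v ++ s ∧ s <+: w := by
  rcases le_total t.length v.length with hl | hl
  · exact .inl (List.prefix_of_prefix_length_le h (List.prefix_append _ _) hl)
  · obtain ⟨s, rfl⟩ := List.prefix_of_prefix_length_le (List.prefix_append _ _) h hl
    exact .inr ⟨s, rfl, (List.prefix_append_right_inj _).1 h⟩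

end Shifts

/-! ### From a transducer with finite shiftlag to a closed set of positions -/

namespace SubseqTransducer

variable {α β Q : Type*} (T : SubseqTransducer α β Q)

/-- The output and the state after reading a word. -/
def runFrom : Q → List α → Option (List β × Q)
  | q, [] => some ([], q)
  | q, a :: u =>
    match T.step q a with
    | none => none
    | some (v, p) => (runFrom p u).map fun x => (v ++ x.1, x.2)

variable {T}

theorem exists_of_outputFrom_append {q : Q} {z t : List α} {y : List β}
    (h : T.outputFrom q (z ++ t) = some y) :
    ∃ o p y' s s', T.runFrom q z = some (o, p) ∧ y = o ++ y' ∧ T.outputFrom p t = some y' ∧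
      T.syncFrom p t = some s' ∧ T.syncFrom q (z ++ t) = some (s ++ s') ∧ pairOf s = (z, o) := by
  have sync : ∀ (t : List α) (q : Q) (y : List β), T.outputFrom q t = some y →
      ∃ s, T.syncFrom q t = some s := by
    intro t
    induction t with
    | nil => intro q y h; exact ⟨_, by simp only [outputFrom] at h; simp only [syncFrom, h]; rfl⟩
    | cons a t ih =>
      intro q y h
      simp only [outputFrom] at h
      simp only [syncFrom]
      cases hs : T.step q a with
      | none => simp [hs] at h
      | some vp =>
        simp only [hs, Option.map_eq_some_iff] at h
        obtain ⟨y', h, -⟩ := h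
        obtain ⟨s, hs'⟩ := ih _ _ h
        exact ⟨_, by simp only [hs']; rfl⟩
  induction z generalizing q y with
  | nil =>
    obtain ⟨s', hs'⟩ := sync t q y h
    exact ⟨[], q, y, [], s', rfl, rfl, h, hs', hs', rfl⟩
  | cons a z ih =>
    simp only [List.cons_append, outputFrom] at h
    cases hs : T.step q a with
    | none => simp [hs] at h
    | some vp =>
      obtain ⟨v, p⟩ := vp
      simp only [hs, Option.map_eq_some_iff] at h
      obtain ⟨y, h, rfl⟩ := h
      obtain ⟨o, p', y', s, s', h1, rfl, h3, h4, h5, h6⟩ := ih h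
      refine ⟨v ++ o, p', y', Sum.inl a :: (v.map Sum.inr ++ s), s', ?_, ?_, h3, h4, ?_, ?_⟩
      · simp [runFrom, hs, h1]
      · simp
      · simp [syncFrom, hs, h5]
      · simp [pairOf_append, h6]

/-- The outputs of single transitions and the final outputs have length at most `ℓ`. -/
def OutputsBounded (T : SubseqTransducer α β Q) (ℓ : ℕ) : Prop :=
  (∀ q a v p, T.step q a = some (v, p) → v.length ≤ ℓ) ∧
    ∀ q v, T.final q = some v → v.length ≤ ℓ

theorem exists_outputsBounded [Finite α] [Finite Q] (T : SubseqTransducer α β Q) :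
    ∃ ℓ, T.OutputsBounded ℓ := by
  obtain ⟨m, hm⟩ := (Set.finite_range fun x : Q × α =>
    ((T.step x.1 x.2).map fun y => y.1.length).getD 0).bddAbove
  obtain ⟨n, hn⟩ := (Set.finite_range fun q : Q => ((T.final q).map List.length).getD 0).bddAbove
  refine ⟨max m n, fun q a v p h => le_max_of_le_left (hm ⟨(q, a), by simp [h]⟩),
    fun q v h => le_max_of_le_right (hn ⟨q, by simp [h]⟩)⟩

/-- Each nonempty transition output follows an input letter and so accounts for a shift of its own.
The summand `1` pays for the final output, which may follow another output directly. -/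
theorem OutputsBounded.length_le {ℓ : ℕ} (hT : T.OutputsBounded ℓ) {t : List α} {q : Q}
    {s w : List (α ⊕ β)} (hs : T.syncFrom q t = some s) (hw : w <+: s) :
    (pairOf w).2.length ≤ ℓ * (nshift w + 1) := by
  have outs : ∀ (v : List β) (w : List (α ⊕ β)), w <+: v.map Sum.inr →
      (pairOf w).2.length ≤ v.length := by
    intro v w hw
    obtain ⟨v', hv', rfl⟩ := List.prefix_map_iff.1 hw
    simpa using hv'.length_le
  induction t generalizing q s w with
  | nil =>
    simp only [syncFrom, Option.map_eq_some_iff] at hs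
    obtain ⟨v, hv, rfl⟩ := hs
    have := hT.2 _ _ hv
    have := outs v w hw
    nlinarith [Nat.zero_le (ℓ * nshift w)]
  | cons a t ih =>
    simp only [syncFrom] at hs
    cases hstep : T.step q a with
    | none => simp [hstep] at hs
    | some vp =>
      obtain ⟨v, p⟩ := vp
      simp only [hstep, Option.map_eq_some_iff] at hs
      obtain ⟨x, hx, rfl⟩ := hs
      have hv := hT.1 _ _ _ _ hstep
      cases w with
      | nil => simp
      | cons c w =>
        obtain ⟨rfl, hw'⟩ := List.cons_prefix_cons.1 hw
        have one : ∀ n : ℕ, ℓ ≤ ℓ * (n + 1) := fun n => Nat.le_mul_of_pos_right _ n.succ_pos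
        rcases prefix_append_cases hw' with h | ⟨w, rfl, h⟩
        · have := outs v w h
          have := one (nshift (Sum.inl a :: w))
          simp only [pairOf_inl_cons]; omega
        · have h1 := ih hx h
          have h2 : (pairOf (Sum.inl a :: (v.map Sum.inr ++ w) : List (α ⊕ β))).2.length =
              v.length + (pairOf w).2.length := by simp [pairOf_append]
          rw [h2]
          have hmono := nshift_le_append_left (Sum.inl a :: v.map Sum.inr) w
          cases v with
          | nil =>
            simp only [List.map_nil, List.nil_append, List.length_nil, zero_add,
              List.singleton_append] at hmono ⊢
            exact h1.trans (Nat.mul_le_mul_left _ (by omega))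
          | cons b v =>
            have hadd := nshift_add_le_append (Sum.inl a :: (b :: v).map Sum.inr) w
            have hpos : 1 ≤ nshift (Sum.inl a :: (b :: v).map Sum.inr : List (α ⊕ β)) := by
              simp [nshift]
            simp only [List.cons_append] at hadd
            have : (pairOf w).2.length ≤ ℓ * (nshift w + 1) := h1
            calc (b :: v).length + (pairOf w).2.length ≤ ℓ + ℓ * (nshift w + 1) := by omega
              _ = ℓ * (nshift w + 1 + 1) := by ring
              _ ≤ _ := Nat.mul_le_mul_left _ (by omega)

/-- With finite shiftlag, an output is either committed to with bounded delay, or the whole output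
is not longer than the input read so far. -/
theorem exists_delay_bound [Finite α] [Finite Q] (hT : FiniteShiftlag T.syncLanguage) :
    ∃ K, 1 ≤ K ∧ ∀ z t y o p, T.outputFrom T.start (z ++ t) = some y →
      T.runFrom T.start z = some (o, p) → z.length < o.length + K ∨ y.length ≤ z.length := by
  obtain ⟨n, hn⟩ := finiteShiftlag_iff.1 hT
  obtain ⟨ℓ, hℓ⟩ := T.exists_outputsBounded
  -- While at most `n + 1` shifts occur, at most `ℓ * (n + 2)` output letters are produced, so a
  -- delay of this size leaves a lag of at least `n + 1` over that stretch. Since `n` bounds the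
  -- shiftlag, `n + 1` further shifts are impossible; hence the remaining output is too short to
  -- catch up with the input read.
  refine ⟨n + 1 + ℓ * (n + 2), by omega, fun z t y o p hy hrun => ?_⟩
  by_contra! hc
  obtain ⟨hc1, hc2⟩ := hc
  obtain ⟨o', p', y', s, s', h1, rfl, h3, h4, h5, h6⟩ := exists_of_outputFrom_append hy
  obtain ⟨rfl, rfl⟩ : o = o' ∧ p = p' := by simpa [hrun] using h1
  have hpair : ∀ (t : List α) (p : Q) (s : List (α ⊕ β)) (y : List β),
      T.outputFrom p t = some y → T.syncFrom p t = some s → (pairOf s).2 = y := by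
    intro t
    induction t with
    | nil =>
      intro p s y h h'
      simp only [outputFrom] at h
      simp only [syncFrom, h, Option.map_some, Option.some.injEq] at h'
      simp [← h']
    | cons a t ih =>
      intro p s y h h'
      simp only [outputFrom] at h
      simp only [syncFrom] at h'
      cases hs : T.step p a with
      | none => simp [hs] at h
      | some vp =>
        simp only [hs, Option.map_eq_some_iff] at h h'
        obtain ⟨y', h, rfl⟩ := h
        obtain ⟨s, h', rfl⟩ := h'
        simp [pairOf_append, ih _ _ _ h h']
  by_cases hsh : n + 1 ≤ nshift s'
  · obtain ⟨w, ⟨r, rfl⟩, hw⟩ := exists_prefix_nshift_eq s' hsh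
    have := hn (s ++ (w ++ r)) ⟨_, h5⟩ (n + 1) (hasLaggedShifts_of_nshift hw.ge fun t' ht' => ?_)
    · omega
    · have h7 := hℓ.length_le h4 (List.prefix_append w r)
      obtain ⟨w', rfl⟩ := ht'
      rw [hw, pairOf_append, List.length_append] at h7
      rw [gain_append, gain_eq_pairOf, gain_eq_pairOf, h6]
      have h8 : ℓ * (n + 2) = ℓ * (n + 1 + 1) := rfl
      simp only
      omega
  · have h7 := hℓ.length_le h4 List.prefix_rfl
    rw [hpair _ _ _ _ h3 h4] at h7
    have h8 : ℓ * (nshift s' + 1) ≤ ℓ * (n + 2) := Nat.mul_le_mul_left _ (by omega)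
    rw [List.length_append] at hc2
    omega

/-- The positions whose committed output is compatible with `T`. -/
def positions (T : SubseqTransducer α β Q) : Set (List α × List β × List α) :=
  {p | p.1.length = p.2.1.length ∧
    ∀ t y, T.outputFrom T.start (p.1 ++ (p.2.2 ++ t)) = some y → p.2.1 <+: y}

/-- After lookahead `z` of length `K`, let `o` be the output of `T` so far. If its delay is less
than `K`, then `o` is longer than `u ++ x`, so it contains an answer to `x`. Otherwise all images
chosen by `T` are short and the position is covered. -/
theorem exists_closed [Finite α] [Finite Q] {R : Set (List α × List β)}
    (hR : IsUniformization T.relation R) (hT : FiniteShiftlag T.syncLanguage) :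
    ∃ K, Closed R T.positions K := by
  obtain ⟨K, hK1, hK⟩ := exists_delay_bound hT
  obtain ⟨-, hdom, hsub⟩ := hR
  have hout : ∀ {u v z}, Dom R u v z → ∃ y, T.outputFrom T.start (u ++ z) = some y := by
    rintro u v z ⟨y, hy⟩
    have : u ++ z ∈ dom T.relation := by rw [hdom]; exact ⟨_, hy⟩
    exact this
  refine ⟨K, ⟨⟨rfl, fun t y _ => List.nil_prefix⟩, fun h => h.1, ?_⟩⟩
  rintro u v x ⟨huv, hv⟩ z hz
  simp only at huv hv
  have hz0 : z ≠ [] := by rintro rfl; simp at hz; omega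
  refine ⟨z, hz0, List.prefix_rfl, ?_⟩
  by_cases hex : ∃ t y, T.outputFrom T.start (u ++ (x ++ z) ++ t) = some y
  swap
  · refine .inl fun t ht => absurd ?_ hex
    obtain ⟨y, hy⟩ := hout ht
    exact ⟨t, y, by simpa using hy⟩
  obtain ⟨t₀, y₀, h₀⟩ := hex
  obtain ⟨o, p, y₁, -, -, hrun, rfl, -⟩ := exists_of_outputFrom_append h₀
  have hpre : ∀ t y, T.outputFrom T.start (u ++ (x ++ z) ++ t) = some y → o <+: y := by
    intro t y hy
    obtain ⟨o', p', y', -, -, hrun', rfl, -⟩ := exists_of_outputFrom_append hy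
    obtain ⟨rfl, rfl⟩ : o = o' ∧ p = p' := by simpa [hrun] using hrun'
    exact List.prefix_append _ _
  by_cases hlag : (u ++ (x ++ z)).length < o.length + K
  · right
    have hvo : v <+: o := by
      refine List.prefix_of_prefix_length_le (hv (z ++ t₀) _ (by simpa using h₀))
        (List.prefix_append _ _) ?_
      simp only [List.length_append] at hlag; omega
    obtain ⟨r, rfl⟩ := hvo
    have hyo : v ++ r.take x.length <+: v ++ r := by
      rw [List.prefix_append_right_inj]; exact List.take_prefix _ _
    have hlen : (r.take x.length).length = x.length := by
      simp only [List.length_append, List.length_take] at hlag ⊢; omega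
    refine ⟨r.take x.length, hlen, ?_, u ++ x, v ++ r.take x.length, ⟨by simp only [List.length_append, hlen, huv], ?_⟩, rfl⟩
    · intro t ht
      obtain ⟨y, hy⟩ := hout ht
      obtain ⟨r', rfl⟩ := hyo.trans (hpre t y (by simpa using hy))
      exact ⟨r', hsub (show T.outputFrom T.start _ = _ by simpa using hy)⟩
    · intro t y hy
      exact hyo.trans (hpre t y (by simpa using hy))
  · left
    intro t ht
    obtain ⟨y, hy⟩ := hout ht
    have hle := (hK _ t y o p (by simpa using hy) hrun).resolve_left hlag
    obtain ⟨y', rfl⟩ := hv (z ++ t) y (by simpa using hy)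
    refine ⟨y', ?_, hsub hy⟩
    simp at hle ⊢; omega

end SubseqTransducer

/-! ### Restriction of a transducer to finitely many states -/

section Restrict

variable {α β : Type*} {S : Type*}

namespace SubseqTransducer

open Classical in
/-- The restriction of a transducer to a set of states. -/
noncomputable def restrict (T : SubseqTransducer α β S) (V : Set S) (h : T.start ∈ V) :
    SubseqTransducer α β V where
  start := ⟨T.start, h⟩
  step q a :=
    match T.step q a with
    | none => none
    | some (y, s) => if hs : s ∈ V then some (y, ⟨s, hs⟩) else none
  final q := T.final q

variable {T : SubseqTransducer α β S} {V : Set S} (h : T.start ∈ V)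

theorem syncFrom_restrict (hV : ∀ s ∈ V, ∀ a y s', T.step s a = some (y, s') → s' ∈ V)
    (t : List α) (q : V) : (T.restrict V h).syncFrom q t = T.syncFrom q t := by
  induction t generalizing q with
  | nil => rfl
  | cons a t ih =>
    simp only [syncFrom, restrict]
    cases hs : T.step q a with
    | none => rfl
    | some ys =>
      obtain ⟨y, s⟩ := ys
      have := hV q q.2 a y s hs
      simp only [this, dif_pos]
      exact congrArg _ (ih ⟨s, this⟩)

theorem outputFrom_restrict (hV : ∀ s ∈ V, ∀ a y s', T.step s a = some (y, s') → s' ∈ V)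
    (t : List α) (q : V) : (T.restrict V h).outputFrom q t = T.outputFrom q t := by
  induction t generalizing q with
  | nil => rfl
  | cons a t ih =>
    simp only [outputFrom, restrict]
    cases hs : T.step q a with
    | none => rfl
    | some ys =>
      obtain ⟨y, s⟩ := ys
      have := hV q q.2 a y s hs
      simp only [this, dif_pos]
      exact congrArg _ (ih ⟨s, this⟩)

end SubseqTransducer

theorem finite_image_of_code {ι γ Y : Type*} [Finite Y] {f : ι → γ} {g : ι → Y} {s : Set ι}
    (h : ∀ i ∈ s, ∀ j ∈ s, g i = g j → f i = f j) : (f '' s).Finite := by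
  classical
  rcases s.eq_empty_or_nonempty with rfl | ⟨i₀, -⟩
  · simp
  refine (Set.finite_range fun y : Y =>
    if hy : ∃ i ∈ s, g i = y then f hy.choose else f i₀).subset ?_
  rintro _ ⟨i, hi, rfl⟩
  have hy : ∃ j ∈ s, g j = g i := ⟨i, hi, rfl⟩
  refine ⟨g i, ?_⟩
  simp only [dif_pos hy]
  exact h _ hy.choose_spec.1 _ hi hy.choose_spec.2

end Restrict

/-! ### From a closed set of positions to a transducer -/

section Strategy

variable {α β X : Type} {R : Set (List α × List β)} {W : Set (List α × List β × List α)} {B : ℕ}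

/-- The states of the transducer that plays a winning strategy: a position together with the input
read since then, or a set of final outputs together with the remaining inputs that allow them. -/
abbrev StratState (α β : Type) :=
  (List α × List β × List α × List α) ⊕ Set (List β × List α)

/-- The outputs of length at most `m` with the remaining inputs `t` that allow them, when `w` has
been read after the pair `(u, v)`. -/
def stopSet (R : Set (List α × List β)) (u : List α) (v : List β) (m : ℕ) (w : List α) :
    Set (List β × List α) :=
  {p | p.1.length ≤ m ∧ (u ++ (w ++ p.2), v ++ p.1) ∈ R}

open Classical in
/-- The transducer that plays according to a winning set of positions. -/
noncomputable def stratTransducer (R : Set (List α × List β))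
    (W : Set (List α × List β × List α)) (B : ℕ) : SubseqTransducer α β (StratState α β) where
  start := .inl ([], [], [], [])
  step s a :=
    match s with
    | .inl (u, v, x, z) =>
      if z.length < B then some ([], .inl (u, v, x, z ++ [a]))
      else if ∃ z', z' <+: z ++ [a] ∧ Covered R u v (x ++ z') then
        some ([], .inr (stopSet R u v (x ++ (z ++ [a])).length (x ++ (z ++ [a]))))
      else if h : ∃ p : List α × List β × List α × List β, p.1 ≠ [] ∧ p.1 <+: z ++ [a] ∧
          p.2.1.length = x.length ∧ Safe R u v x p.2.1 p.1 ∧ (p.2.2.1, p.2.2.2, p.1) ∈ W ∧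
          res R (u ++ x) (v ++ p.2.1) = res R p.2.2.1 p.2.2.2 then
        some (h.choose.2.1, .inl (h.choose.2.2.1, h.choose.2.2.2, h.choose.1,
          (z ++ [a]).drop h.choose.1.length))
      else none
    | .inr G => some ([], .inr {p | (p.1, a :: p.2) ∈ G})
  final s :=
    match s with
    | .inl (u, v, x, z) => if h : Dom R u v (x ++ z) then some h.choose else none
    | .inr G => if h : ∃ y, (y, []) ∈ G then some h.choose else none

theorem stratTransducer_step_cases {u : List α} {v : List β} {x z : List α} {a : α} {o : List β}
    {s : StratState α β}
    (h : (stratTransducer R W B).step (.inl (u, v, x, z)) a = some (o, s)) :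
    (z.length < B ∧ o = [] ∧ s = .inl (u, v, x, z ++ [a])) ∨
    (B ≤ z.length ∧ o = [] ∧
      s = .inr (stopSet R u v (x ++ (z ++ [a])).length (x ++ (z ++ [a]))) ∧
      ∃ z', z' <+: z ++ [a] ∧ Covered R u v (x ++ z')) ∨
    ∃ z' r u' v', z' ≠ [] ∧ z ++ [a] = z' ++ r ∧ o.length = x.length ∧ Safe R u v x o z' ∧
      (u', v', z') ∈ W ∧ res R (u ++ x) (v ++ o) = res R u' v' ∧ s = .inl (u', v', z', r) := by
  simp only [stratTransducer] at h
  split_ifs at h with h1 h2 h3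
  · simp only [Option.some.injEq, Prod.mk.injEq] at h
    exact .inl ⟨h1, h.1.symm, h.2.symm⟩
  · simp only [Option.some.injEq, Prod.mk.injEq] at h
    exact .inr (.inl ⟨not_lt.1 h1, h.1.symm, h.2.symm, h2⟩)
  · simp only [Option.some.injEq, Prod.mk.injEq] at h
    obtain ⟨rfl, rfl⟩ := h
    obtain ⟨a1, a2, a3, a4, a5, a6⟩ := h3.choose_spec
    refine .inr (.inr ⟨_, _, _, _, a1, ?_, a3, a4, a5, a6, rfl⟩)
    exact (List.prefix_iff_eq_append.1 a2).symm

theorem stratTransducer_step_isSome (hW : Closed R W B) {u : List α} {v : List β} {x z : List α}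
    (h : (u, v, x) ∈ W) (a : α) :
    ∃ o s, (stratTransducer R W B).step (.inl (u, v, x, z)) a = some (o, s) := by
  simp only [stratTransducer]
  split_ifs with h1 h2 h3
  · exact ⟨_, _, rfl⟩
  · exact ⟨_, _, rfl⟩
  · exact ⟨_, _, rfl⟩
  · exfalso
    obtain ⟨z', a1, a2, hc | ⟨y, b1, b2, u', v', b3, b4⟩⟩ :=
      hW.good h ((z ++ [a]).take B) (by simp; omega)
    · exact h2 ⟨z', a2.trans (List.take_prefix _ _), hc⟩
    · exact h3 ⟨(z', y, u', v'), a1, a2.trans (List.take_prefix _ _), b1, b2, b3, b4⟩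

/-- The invariant that holds after the input `h` has been read and `o` has been output. -/
def StratInv (R : Set (List α × List β)) (W : Set (List α × List β × List α)) (h : List α)
    (o : List β) : StratState α β → Prop
  | .inl (u, v, x, z) => (u, v, x) ∈ W ∧ ∃ h₀, h = h₀ ++ (x ++ z) ∧ h₀.length = o.length ∧
      res R h₀ o = res R u v ∧ ∀ t, Dom R [] [] (h ++ t) → Dom R h₀ o (x ++ (z ++ t))
  | .inr G => (∀ y t, (y, t) ∈ G → (h ++ t, o ++ y) ∈ R) ∧
      ∀ t, Dom R [] [] (h ++ t) → ∃ y, (y, t) ∈ G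

theorem StratInv.step (hW : Closed R W B) {h : List α} {o : List β} {s : StratState α β}
    (hs : StratInv R W h o s) (a : α) : ∃ y s', (stratTransducer R W B).step s a = some (y, s') ∧
      StratInv R W (h ++ [a]) (o ++ y) s' := by
  rcases s with ⟨u, v, x, z⟩ | G
  · obtain ⟨hx, h₀, rfl, hlen, hres, hd⟩ := hs
    obtain ⟨y, s', hstep⟩ := stratTransducer_step_isSome hW hx (z := z) a
    refine ⟨y, s', hstep, ?_⟩
    obtain ⟨-, rfl, rfl⟩ | ⟨-, rfl, rfl, z', ⟨r, hr⟩, hc⟩ |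
      ⟨z', r, u', v', -, hz', hy, hsafe, hW', hres', rfl⟩ := stratTransducer_step_cases hstep
    · refine ⟨hx, h₀, by simp, by simpa using hlen, by simpa using hres, fun t ht => ?_⟩
      simpa using hd (a :: t) (by simpa using ht)
    · constructor
      · rintro y t ⟨-, hR⟩
        rw [← mem_iff_of_res_eq hres] at hR
        simpa using hR
      · intro t ht
        have h1 := (dom_iff_of_res_eq hres _).1 (hd (a :: t) (by simpa using ht))
        have h2 : x ++ (z ++ a :: t) = (x ++ z') ++ (r ++ t) := by
          have : z ++ a :: t = (z ++ [a]) ++ t := by simp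
          rw [this, ← hr]; simp
        obtain ⟨y, h3, h4⟩ := hc (r ++ t) (by rwa [← h2])
        refine ⟨y, ?_, ?_⟩
        · simp only [← hr, List.length_append] at h3 ⊢; omega
        · rw [← h2] at h4; simpa using h4
    · have hxy := (res_append_congr hres x y).trans hres'
      refine ⟨hW', h₀ ++ x, ?_, by simp [hlen, hy], hxy, fun t ht => ?_⟩
      · rw [← hz']; simp
      · rw [dom_iff_of_res_eq (res_append_congr hres x y), ← List.append_assoc, ← hz']
        have h1 := (dom_iff_of_res_eq hres _).1 (hd (a :: t) (by simpa using ht))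
        have h2 : z ++ a :: t = z' ++ (r ++ t) := by
          rw [← List.append_assoc, ← hz']; simp
        rw [h2] at h1
        rw [hz', List.append_assoc]
        exact hsafe _ h1
  · refine ⟨[], _, rfl, fun y t hyt => ?_, fun t ht => ?_⟩
    · simpa using hs.1 y (a :: t) hyt
    · exact hs.2 (a :: t) (by simpa using ht)

theorem StratInv.output (hW : Closed R W B) {h : List α} {o : List β} {s : StratState α β}
    (hs : StratInv R W h o s) (t : List α) :
    (∀ y, (stratTransducer R W B).outputFrom s t = some y → (h ++ t, o ++ y) ∈ R) ∧
      (Dom R [] [] (h ++ t) → ∃ y, (stratTransducer R W B).outputFrom s t = some y) := by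
  induction t generalizing h o s with
  | nil =>
    rcases s with ⟨u, v, x, z⟩ | G
    · obtain ⟨hx, h₀, rfl, hlen, hres, hd⟩ := hs
      simp only [SubseqTransducer.outputFrom, stratTransducer]
      constructor
      · intro y hy
        split_ifs at hy with h1
        cases hy
        have := (mem_iff_of_res_eq hres _ _).2 h1.choose_spec
        simpa using this
      · intro hdom
        rw [dif_pos]
        · exact ⟨_, rfl⟩
        · simpa using (dom_iff_of_res_eq hres _).1 (hd [] hdom)
    · simp only [SubseqTransducer.outputFrom, stratTransducer]
      constructor
      · intro y hy
        split_ifs at hy with h1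
        cases hy
        exact hs.1 _ _ h1.choose_spec
      · intro hdom
        rw [dif_pos (hs.2 [] hdom)]
        exact ⟨_, rfl⟩
  | cons a t ih =>
    obtain ⟨y, s', hstep, hinv⟩ := hs.step hW a
    have := ih hinv
    simp only [SubseqTransducer.outputFrom, hstep, Option.map_eq_some_iff]
    constructor
    · rintro _ ⟨y', hy', rfl⟩
      simpa using this.1 y' hy'
    · intro hd
      obtain ⟨y', hy'⟩ := this.2 (by simpa using hd)
      exact ⟨_, y', hy', rfl⟩

theorem isUniformization_stratTransducer (hW : Closed R W B) :
    IsUniformization (stratTransducer R W B).relation R := by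
  have hinit : StratInv R W [] [] (stratTransducer R W B).start :=
    ⟨hW.init, [], rfl, rfl, rfl, fun t ht => ht⟩
  have hout := fun t => hinit.output hW t
  refine ⟨?_, ?_, ?_⟩
  · intro u v v' h h'
    exact Option.some.inj (h.symm.trans h')
  · ext u
    constructor
    · rintro ⟨v, hv⟩
      exact ⟨v, (hout u).1 v hv⟩
    · rintro ⟨v, hv⟩
      exact (hout u).2 ⟨v, hv⟩
  · rintro ⟨u, v⟩ h
    exact (hout u).1 v h

theorem stratTransducer_syncFrom_inr {G : Set (List β × List α)} {t : List α} {w : List (α ⊕ β)}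
    (h : (stratTransducer R W B).syncFrom (.inr G) t = some w) :
    ∃ (i : List α) (o : List β), w = i.map Sum.inl ++ o.map Sum.inr := by
  induction t generalizing G w with
  | nil =>
    simp only [SubseqTransducer.syncFrom, Option.map_eq_some_iff] at h
    obtain ⟨v, -, rfl⟩ := h
    exact ⟨[], v, rfl⟩
  | cons a t ih =>
    simp only [SubseqTransducer.syncFrom, stratTransducer, Option.map_eq_some_iff] at h
    obtain ⟨x, hx, rfl⟩ := h
    obtain ⟨i, o, rfl⟩ := ih hx
    exact ⟨a :: i, o, by simp⟩

/-- The quantity `x.length + z.length + gain t` counts the input letters that are not yet answered.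
It stays between `0` and `2 * B + 1` until the transducer stops answering; then only inputs and a
final output follow. -/
theorem stratTransducer_syncFrom_inl (hx : ∀ u v x, (u, v, x) ∈ W → x.length ≤ B)
    {u : List α} {v : List β} {x z : List α} {t : List α} {w : List (α ⊕ β)}
    (hW : (u, v, x) ∈ W) (hz : z.length ≤ B)
    (h : (stratTransducer R W B).syncFrom (.inl (u, v, x, z)) t = some w) :
    ∃ (p : List (α ⊕ β)) (i : List α) (o : List β), w = p ++ (i.map Sum.inl ++ o.map Sum.inr) ∧
      ∀ t, t <+: p → 0 ≤ x.length + z.length + gain t ∧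
        x.length + z.length + gain t ≤ 2 * B + 1 := by
  induction t generalizing u v x z w with
  | nil =>
    simp only [SubseqTransducer.syncFrom, Option.map_eq_some_iff] at h
    obtain ⟨y, -, rfl⟩ := h
    refine ⟨[], [], y, rfl, fun t ht => ?_⟩
    have := hx _ _ _ hW
    rw [List.prefix_nil.1 ht, gain_nil]
    omega
  | cons a t ih =>
    have hxB := hx _ _ _ hW
    simp only [SubseqTransducer.syncFrom] at h
    cases hstep : (stratTransducer R W B).step (.inl (u, v, x, z)) a with
    | none => simp [hstep] at h
    | some ys =>
      obtain ⟨y, s⟩ := ys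
      simp only [hstep, Option.map_eq_some_iff] at h
      obtain ⟨w, hw, rfl⟩ := h
      have hcons : ∀ q : List (α ⊕ β), gain (Sum.inl a :: q) = 1 + gain q := by
        intro q; simp [gain_eq_sum]
      obtain ⟨hlt, rfl, rfl⟩ | ⟨-, rfl, rfl, -⟩ |
        ⟨z', r, u', v', hz', hzr, hy, -, hW', -, rfl⟩ := stratTransducer_step_cases hstep
      · obtain ⟨p, i, o, rfl, hp⟩ := ih hW (by simp; omega) hw
        refine ⟨Sum.inl a :: p, i, o, by simp, fun t ht => ?_⟩
        cases t with
        | nil => simp only [gain_nil]; omega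
        | cons c t =>
          obtain ⟨rfl, ht'⟩ := List.cons_prefix_cons.1 ht
          have := hp t ht'
          rw [hcons]
          simp at this
          omega
      · obtain ⟨i, o, rfl⟩ := stratTransducer_syncFrom_inr hw
        refine ⟨[], a :: i, o, by simp, fun t ht => ?_⟩
        rw [List.prefix_nil.1 ht, gain_nil]
        omega
      · have hzr' := congrArg List.length hzr
        simp only [List.length_append, List.length_singleton] at hzr'
        have := List.length_pos_iff.2 hz'
        obtain ⟨p, i, o, rfl, hp⟩ := ih hW' (by omega) hw
        refine ⟨Sum.inl a :: (y.map Sum.inr ++ p), i, o, by simp, fun t ht => ?_⟩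
        have hinr : ∀ y : List β, gain (y.map Sum.inr : List (α ⊕ β)) = - (y.length : ℤ) := by
          intro y; simp [gain_eq_pairOf]
        cases t with
        | nil => simp only [gain_nil]; omega
        | cons c t =>
          obtain ⟨rfl, ht'⟩ := List.cons_prefix_cons.1 ht
          rw [hcons]
          rcases prefix_append_cases ht' with ht | ⟨t, rfl, ht''⟩
          · obtain ⟨y', hy', rfl⟩ := List.prefix_map_iff.1 ht
            have := hy'.length_le
            rw [hinr]
            omega
          · have := hp t ht''
            rw [gain_append, hinr]
            omega

theorem nshift_map_inl_append_map_inr (i : List α) (o : List β) :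
    nshift (i.map Sum.inl ++ o.map Sum.inr) ≤ 1 := by
  have h0 : nshift (o.map Sum.inr : List (α ⊕ β)) = 0 := by
    induction o with
    | nil => rfl
    | cons b o ih => cases o <;> simp_all [nshift]
  induction i with
  | nil => simp [h0]
  | cons a i ih =>
    cases i with
    | nil => cases o <;> simp_all [nshift]
    | cons c i => simpa [nshift] using ih

theorem finiteShiftlag_stratTransducer (hW : Closed R W B)
    (hx : ∀ u v x, (u, v, x) ∈ W → x.length ≤ B) :
    FiniteShiftlag (stratTransducer R W B).syncLanguage := by
  refine finiteShiftlag_iff.2 ⟨max (2 * B + 1) 1, ?_⟩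
  rintro w ⟨t, ht⟩ m hm
  obtain ⟨p, i, o, rfl, hp⟩ := stratTransducer_syncFrom_inl hx hW.init (Nat.zero_le _) ht
  refine (le_of_hasLaggedShifts hm (B := 2 * B + 1) fun t ht => ?_).trans
    (max_le_max le_rfl (nshift_map_inl_append_map_inr i o))
  have := hp t ht
  simp at this
  omega

/-- The states that the strategy transducer visits. -/
def stratStates (R : Set (List α × List β)) (W : Set (List α × List β × List α)) (B : ℕ) :
    Set (StratState α β) :=
  Sum.inl '' {p | (p.1, p.2.1, p.2.2.1) ∈ W ∧ p.2.2.2.length ≤ B} ∪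
    Sum.inr '' ⋃ p ∈ {p | p ∈ W}, ⋃ m ∈ Set.Iic (2 * B + 1),
      stopSet R p.1 p.2.1 m '' {w | m ≤ w.length}

/-- Infinitely many `w` occur in the stop sets, but only finitely many sets arise. An output of
length at most `m ≤ w.length` leaves a pair whose one-sided residual has a code, and there are
finitely many such outputs. -/
theorem finite_stratStates [Finite α] [Finite β] [Finite X] (e : ResidualCode R X)
    (hW : W.Finite) (hlen : ∀ {u v x}, (u, v, x) ∈ W → u.length = v.length) (B : ℕ) :
    (stratStates R W B).Finite := by
  refine .union (.image _ ?_) (.image _ ?_)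
  · refine ((hW.prod (List.finite_length_le α B)).image
      fun p => (p.1.1, p.1.2.1, p.1.2.2, p.2)).subset ?_
    rintro ⟨u, v, x, z⟩ ⟨h1, h2⟩
    exact ⟨((u, v, x), z), ⟨h1, h2⟩, rfl⟩
  · refine hW.biUnion fun p hp => (Set.finite_Iic _).biUnion fun m hm => ?_
    have : Finite {y : List β // y.length ≤ m} := List.finite_length_le β m
    refine finite_image_of_code
      (g := fun w (y : {y : List β // y.length ≤ m}) => e.code (p.1 ++ w) (p.2.1 ++ y.1)) ?_
    intro w hw w' hw' h
    ext ⟨y, t⟩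
    simp only [stopSet, Set.mem_ofPred_eq]
    refine and_congr_right fun hy => ?_
    have huv := hlen (show (p.1, p.2.1, p.2.2) ∈ W from hp)
    have h1 : e.code (p.1 ++ w) (p.2.1 ++ y) = e.code (p.1 ++ w') (p.2.1 ++ y) :=
      congrFun h ⟨y, hy⟩
    have hw1 : m ≤ w.length := hw
    have hw2 : m ≤ w'.length := hw'
    have h2 := e.resIn_eq (by simp only [List.length_append]; omega)
      (by simp only [List.length_append]; omega) h1
    simpa using mem_iff_of_resIn_eq h2 t

theorem step_mem_stratStates (hx : ∀ u v x, (u, v, x) ∈ W → x.length ≤ B)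
    {s : StratState α β} (hs : s ∈ stratStates R W B) {a : α} {y : List β} {s' : StratState α β}
    (h : (stratTransducer R W B).step s a = some (y, s')) : s' ∈ stratStates R W B := by
  obtain ⟨⟨u, v, x, z⟩, ⟨hW, hz⟩, rfl⟩ | ⟨G, hG, rfl⟩ := hs
  · simp only at hW hz
    have hxB := hx _ _ _ hW
    obtain ⟨hlt, rfl, rfl⟩ | ⟨-, rfl, rfl, -⟩ |
      ⟨z', r, u', v', hz', hzr, hy, -, hW', -, rfl⟩ := stratTransducer_step_cases h
    · exact .inl ⟨_, ⟨hW, by simp; omega⟩, rfl⟩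
    · refine .inr ⟨_, Set.mem_biUnion (show (u, v, x) ∈ {p | p ∈ W} from hW)
        (Set.mem_biUnion (Set.mem_Iic.2 ?_) ⟨_, (le_rfl :
          (x ++ (z ++ [a])).length ≤ _), rfl⟩), rfl⟩
      simp; omega
    · have hzr' := congrArg List.length hzr
      simp only [List.length_append, List.length_singleton] at hzr'
      have := List.length_pos_iff.2 hz'
      exact .inl ⟨_, ⟨hW', by simp only; omega⟩, rfl⟩
  · simp only [stratTransducer, Option.some.injEq, Prod.mk.injEq] at h
    obtain ⟨-, rfl⟩ := h
    simp only [Set.mem_iUnion] at hG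
    obtain ⟨p, hp, m, hm, w, hw, rfl⟩ := hG
    refine .inr ⟨_, Set.mem_biUnion hp (Set.mem_biUnion hm ⟨w ++ [a], ?_, ?_⟩), rfl⟩
    · have hw' : m ≤ w.length := hw
      show m ≤ (w ++ [a]).length
      simp; omega
    · ext ⟨y, t⟩
      simp [stopSet]

/-- A winning set of positions yields a transducer. -/
theorem Closed.hasFSLSubseqUniformization [Finite α] [Finite β] [Finite X] (e : ResidualCode R X)
    (hW : Closed R W B) (hb : ∀ u v x, (u, v, x) ∈ W → u.length ≤ B ∧ x.length ≤ B) :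
    HasFSLSubseqUniformization R := by
  have hfin : W.Finite := by
    refine ((List.finite_length_le α B).prod
      ((List.finite_length_le β B).prod (List.finite_length_le α B))).subset ?_
    rintro ⟨u, v, x⟩ h
    have h1 := hb _ _ _ h
    have h2 := hW.length_eq h
    exact ⟨h1.1, h2.symm.le.trans h1.1, h1.2⟩
  have hx : ∀ u v x, (u, v, x) ∈ W → x.length ≤ B := fun u v x h => (hb u v x h).2
  have hstart : (stratTransducer R W B).start ∈ stratStates R W B :=
    .inl ⟨([], [], [], []), ⟨hW.init, Nat.zero_le _⟩, rfl⟩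
  have hV : ∀ s ∈ stratStates R W B, ∀ a y s', (stratTransducer R W B).step s a = some (y, s') →
      s' ∈ stratStates R W B := fun s hs a y s' h => step_mem_stratStates hx hs h
  refine ⟨stratStates R W B, finite_stratStates e hfin hW.length_eq B,
    (stratTransducer R W B).restrict _ hstart, ?_, ?_⟩
  · have : ((stratTransducer R W B).restrict _ hstart).relation =
        (stratTransducer R W B).relation := by
      ext p
      simp only [SubseqTransducer.relation, SubseqTransducer.outputFrom_restrict hstart hV]
      rfl
    rw [this]
    exact isUniformization_stratTransducer hW
  · have : ((stratTransducer R W B).restrict _ hstart).syncLanguage =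
        (stratTransducer R W B).syncLanguage := by
      ext w
      simp only [SubseqTransducer.syncLanguage, SubseqTransducer.syncFrom_restrict hstart hV]
      rfl
    rw [this]
    exact finiteShiftlag_stratTransducer hW hx

end Strategy

/-! ### Bounding all quantifiers of the game -/

section Bounded

variable {α β X : Type*}

/-- `Dom`, with bounded search for the output. -/
def DomB (R : Set (List α × List β)) (B : ℕ) (u : List α) (v : List β) (z : List α) : Prop :=
  ∃ y : List β, y.length ≤ z.length + B ∧ (u ++ z, v ++ y) ∈ R

/-- `Covered`, for continuations of bounded length. -/
def CoveredB (R : Set (List α × List β)) (B : ℕ) (u : List α) (v : List β) (x : List α) : Prop :=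
  ∀ t : List α, t.length ≤ B → DomB R B u v (x ++ t) →
    ∃ y : List β, y.length ≤ x.length ∧ (u ++ (x ++ t), v ++ y) ∈ R

/-- `Safe`, for continuations of bounded length. -/
def SafeB (R : Set (List α × List β)) (B : ℕ) (u : List α) (v : List β) (x : List α) (y : List β)
    (z : List α) : Prop :=
  ∀ t : List α, t.length ≤ B → DomB R B u v (x ++ (z ++ t)) →
    DomB R B (u ++ x) (v ++ y) (z ++ t)

/-- Two pairs have the same residuals, as far as words of bounded length are concerned. -/
def ResEqB (R : Set (List α × List β)) (B : ℕ) (u : List α) (v : List β) (u' : List α)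
    (v' : List β) : Prop :=
  ∀ x : List α, x.length ≤ 2 * B → ∀ y : List β, y.length ≤ 2 * B →
    ((u ++ x, v ++ y) ∈ R ↔ (u' ++ x, v' ++ y) ∈ R)

/-- `Good`, with bounded quantifiers. -/
def GoodB (R : Set (List α × List β)) (B : ℕ) (W : List (List α × List β × List α)) (u : List α)
    (v : List β) (x z : List α) : Prop :=
  CoveredB R B u v (x ++ z) ∨ ∃ y : List β, y.length ≤ x.length ∧ y.length = x.length ∧
    SafeB R B u v x y z ∧ ∃ p ∈ W, p.2.2 = z ∧ ResEqB R B (u ++ x) (v ++ y) p.1 p.2.1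

/-- The list `W` is a winning set of positions with words of length at most `B`. -/
def ClosedB (R : Set (List α × List β)) (B : ℕ) (W : List (List α × List β × List α)) : Prop :=
  ([], [], []) ∈ W ∧ ∀ p ∈ W, p.1.length = p.2.1.length ∧
    ∀ z : List α, z.length ≤ B → z.length = B →
      ∃ n < B, GoodB R B W p.1 p.2.1 p.2.2 (z.take (n + 1))

variable {R : Set (List α × List β)} [Fintype X] (e : ResidualCode R X) {B : ℕ}
  (hB : Fintype.card (ProfilePairCode X) ≤ B)
include e hB

omit e in
-- All finite types used for codes below embed into `ProfilePairCode X`, so a single bound `B`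
-- serves every shortening argument.
theorem card_code_le : Fintype.card X ≤ B ∧ Fintype.card (X × X) ≤ B ∧
    Fintype.card ((Set (X × X) × Set (X × X)) × Set X) ≤ B := by
  refine ⟨(Fintype.card_le_of_injective (fun x => (({(x, x)}, ∅), (∅, ∅))) ?_).trans hB,
    (Fintype.card_le_of_injective (fun x => (({x}, ∅), (∅, ∅))) ?_).trans hB,
    (Fintype.card_le_of_injective (fun x => (x.1, ((fun a => (a, a)) '' x.2, ∅))) ?_).trans hB⟩
  · intro x y h
    simpa using h
  · intro x y h
    simpa using h
  · rintro ⟨x, c⟩ ⟨y, d⟩ h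
    simp only [Prod.mk.injEq, and_true] at h
    have hinj : Function.Injective fun a : X => (a, a) := fun a b h => (Prod.mk.inj h).1
    exact Prod.ext h.1 (hinj.image_injective h.2)

/-- Output beyond the length of the input can be shortened, since there only the residual `resOut`
matters. -/
theorem dom_iff_domB {u : List α} {v : List β} (huv : u.length = v.length) (z : List α) :
    Dom R u v z ↔ DomB R B u v z := by
  refine ⟨?_, fun ⟨y, _, h⟩ => ⟨y, h⟩⟩
  rintro ⟨y, hy⟩
  rcases le_total y.length z.length with hle | hle
  · exact ⟨y, by omega, hy⟩
  have hy₁ : (y.take z.length).length = z.length := by simp; omega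
  obtain ⟨y₂, h1, h2⟩ := exists_short
    (f := fun t => resOut R (u ++ z) (v ++ (y.take z.length ++ t)))
    (c := fun t => e.code (u ++ z) (v ++ (y.take z.length ++ t)))
    (fun w w' t h => by
      ext s
      simpa [resOut] using Set.ext_iff.1 h (t ++ s))
    (fun w w' h => e.resOut_eq (by simp only [List.length_append]; omega)
      (by simp only [List.length_append]; omega) h) (y.drop z.length)
  refine ⟨y.take z.length ++ y₂, ?_, ?_⟩
  · have := (card_code_le hB).1
    simp only [List.length_append]
    omega
  · have h3 : [] ∈ resOut R (u ++ z) (v ++ (y.take z.length ++ y.drop z.length)) := by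
      simpa [resOut] using hy
    rw [← h1] at h3
    simpa [resOut] using h3

/-- The continuation `t` is shortened so that two things are preserved: the profile of `x ++ t`,
which decides membership in the domain, and the set of one-sided residuals reached by outputs no
longer than `x`. -/
theorem covered_iff_coveredB {u : List α} {v : List β} (huv : u.length = v.length) (x : List α) :
    Covered R u v x ↔ CoveredB R B u v x := by
  constructor
  · exact fun h t _ ht => h t ((dom_iff_domB e hB huv _).2 ht)
  · intro h t ht
    obtain ⟨t', h1, h2⟩ := exists_short
      (f := fun t => (profile R (x ++ t),
        {S | ∃ y : List β, y.length ≤ x.length ∧ S = resIn R (u ++ (x ++ t)) (v ++ y)}))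
      (c := fun t => (profileCode e (x ++ t),
        {c | ∃ y : List β, y.length ≤ x.length ∧ c = e.code (u ++ (x ++ t)) (v ++ y)}))
      (fun w w' t h => by
        simp only [Prod.mk.injEq] at h ⊢
        refine ⟨by simpa using profile_append_congr h.1 t, ?_⟩
        have main : ∀ w w', {S | ∃ y : List β, y.length ≤ x.length ∧
            S = resIn R (u ++ (x ++ w)) (v ++ y)} = {S | ∃ y : List β, y.length ≤ x.length ∧
            S = resIn R (u ++ (x ++ w')) (v ++ y)} → {S | ∃ y : List β, y.length ≤ x.length ∧
            S = resIn R (u ++ (x ++ (w ++ t))) (v ++ y)} ⊆ {S | ∃ y : List β, y.length ≤ x.length ∧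
            S = resIn R (u ++ (x ++ (w' ++ t))) (v ++ y)} := by
          rintro w w' h S ⟨y, hy, rfl⟩
          obtain ⟨y', hy', h'⟩ : resIn R (u ++ (x ++ w)) (v ++ y) ∈ {S | ∃ y : List β,
            y.length ≤ x.length ∧ S = resIn R (u ++ (x ++ w')) (v ++ y)} := h ▸ ⟨y, hy, rfl⟩
          exact ⟨y', hy', by simpa using resIn_append_congr h' t⟩
        exact (main w w' h.2).antisymm (main w' w h.2.symm))
      (fun w w' h => by
        simp only [Prod.mk.injEq] at h ⊢
        refine ⟨profile_eq_of_profileCode_eq e h.1, ?_⟩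
        have main : ∀ w w', {c | ∃ y : List β, y.length ≤ x.length ∧
            c = e.code (u ++ (x ++ w)) (v ++ y)} = {c | ∃ y : List β, y.length ≤ x.length ∧
            c = e.code (u ++ (x ++ w')) (v ++ y)} → {S | ∃ y : List β, y.length ≤ x.length ∧
            S = resIn R (u ++ (x ++ w)) (v ++ y)} ⊆ {S | ∃ y : List β, y.length ≤ x.length ∧
            S = resIn R (u ++ (x ++ w')) (v ++ y)} := by
          rintro w w' h S ⟨y, hy, rfl⟩
          obtain ⟨y', hy', h'⟩ : e.code (u ++ (x ++ w)) (v ++ y) ∈ {c | ∃ y : List β,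
            y.length ≤ x.length ∧ c = e.code (u ++ (x ++ w')) (v ++ y)} := h ▸ ⟨y, hy, rfl⟩
          exact ⟨y', hy', e.resIn_eq (by simp only [List.length_append]; omega)
            (by simp only [List.length_append]; omega) h'⟩
        exact (main w w' h.2).antisymm (main w' w h.2.symm)) t
    simp only [Prod.mk.injEq] at h1
    have hcard := (card_code_le hB).2.2
    obtain ⟨y, h3, h4⟩ := h t' (h2.trans hcard)
      ((dom_iff_domB e hB huv _).1 (ht.of_profile_eq h1.1.symm huv))
    obtain ⟨y', hy', h'⟩ : resIn R (u ++ (x ++ t')) (v ++ y) ∈ {S | ∃ y : List β,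
      y.length ≤ x.length ∧ S = resIn R (u ++ (x ++ t)) (v ++ y)} := h1.2 ▸ ⟨y, h3, rfl⟩
    exact ⟨y', hy', by simpa using (mem_iff_of_resIn_eq h' []).1 (by simpa using h4)⟩

theorem safe_iff_safeB {u : List α} {v : List β} (huv : u.length = v.length) {x : List α}
    {y : List β} (hxy : y.length = x.length) (z : List α) :
    Safe R u v x y z ↔ SafeB R B u v x y z := by
  have huv' : (u ++ x).length = (v ++ y).length := by simp only [List.length_append]; omega
  constructor
  · exact fun h t _ ht => (dom_iff_domB e hB huv' _).1 (h t ((dom_iff_domB e hB huv _).2 ht))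
  · intro h t ht
    obtain ⟨t', h1, h2⟩ := exists_short
      (f := fun t => (profile R (x ++ (z ++ t)), profile R (z ++ t)))
      (c := fun t => (profileCode e (x ++ (z ++ t)), profileCode e (z ++ t)))
      (fun w w' t h => by
        simp only [Prod.mk.injEq] at h ⊢
        exact ⟨by simpa using profile_append_congr h.1 t, by simpa using profile_append_congr h.2 t⟩)
      (fun w w' h => by
        simp only [Prod.mk.injEq] at h ⊢
        exact ⟨profile_eq_of_profileCode_eq e h.1, profile_eq_of_profileCode_eq e h.2⟩) t
    simp only [Prod.mk.injEq] at h1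
    have h3 := h t' (h2.trans hB) ((dom_iff_domB e hB huv _).1 (ht.of_profile_eq h1.1.symm huv))
    exact ((dom_iff_domB e hB huv' _).2 h3).of_profile_eq h1.2 huv'

/-- A test pair `(x, y)` splits into a part of equal lengths, a word over `α × β`, and a surplus on
one side. Each is shortened to length at most `B`, simultaneously for both residuals; hence `2 * B`.
-/
theorem res_eq_iff_resEqB {u u' : List α} {v v' : List β} (huv : u.length = v.length)
    (huv' : u'.length = v'.length) : res R u v = res R u' v' ↔ ResEqB R B u v u' v' := by
  constructor
  · exact fun h x _ y _ => mem_iff_of_res_eq h x y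
  intro h
  have hcard := (card_code_le hB).2.1
  have same : ∀ (w : List (α × β)) (x : List α) (y : List β),
      (x = [] ∨ y = []) → x.length ≤ B → y.length ≤ B →
      ((u ++ (w.map Prod.fst ++ x), v ++ (w.map Prod.snd ++ y)) ∈ R ↔
        (u' ++ (w.map Prod.fst ++ x), v' ++ (w.map Prod.snd ++ y)) ∈ R) := by
    intro w x y hxy hx hy
    obtain ⟨w', h1, h2⟩ := exists_short
      (f := fun w : List (α × β) => (res R (u ++ w.map Prod.fst) (v ++ w.map Prod.snd),
        res R (u' ++ w.map Prod.fst) (v' ++ w.map Prod.snd)))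
      (c := fun w : List (α × β) => (e.code (u ++ w.map Prod.fst) (v ++ w.map Prod.snd),
        e.code (u' ++ w.map Prod.fst) (v' ++ w.map Prod.snd)))
      (fun w w' t h => by
        simp only [Prod.mk.injEq] at h ⊢
        exact ⟨by simpa using res_append_congr h.1 _ _, by simpa using res_append_congr h.2 _ _⟩)
      (fun w w' h => by
        simp only [Prod.mk.injEq] at h ⊢
        exact ⟨e.res_eq (by simp [huv]) (by simp [huv]) h.1,
          e.res_eq (by simp [huv']) (by simp [huv']) h.2⟩) w
    simp only [Prod.mk.injEq] at h1
    have h3 := h (w'.map Prod.fst ++ x) (by simp only [List.length_append, List.length_map]; omega)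
      (w'.map Prod.snd ++ y) (by simp only [List.length_append, List.length_map]; omega)
    have h4 := mem_iff_of_res_eq h1.1 x y
    have h5 := mem_iff_of_res_eq h1.2 x y
    simp only [List.append_assoc] at h4 h5
    rw [← h4, ← h5, h3]
  ext ⟨x, y⟩
  simp only [res, Set.mem_ofPred_eq]
  rcases le_total x.length y.length with hle | hle
  · have hx : (x.zip (y.take x.length)).map Prod.fst = x := by
      rw [List.map_fst_zip]; simp; omega
    have hy : (x.zip (y.take x.length)).map Prod.snd = y.take x.length := by
      rw [List.map_snd_zip]; simp
    obtain ⟨t, h1, h2⟩ := exists_short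
      (f := fun t => (resOut R (u ++ x) (v ++ (y.take x.length ++ t)),
        resOut R (u' ++ x) (v' ++ (y.take x.length ++ t))))
      (c := fun t => (e.code (u ++ x) (v ++ (y.take x.length ++ t)),
        e.code (u' ++ x) (v' ++ (y.take x.length ++ t))))
      (fun w w' t h => by
        simp only [Prod.mk.injEq] at h ⊢
        constructor
        · ext s; simpa [resOut] using Set.ext_iff.1 h.1 (t ++ s)
        · ext s; simpa [resOut] using Set.ext_iff.1 h.2 (t ++ s))
      (fun w w' h => by
        simp only [Prod.mk.injEq] at h ⊢
        constructor
        · refine e.resOut_eq ?_ ?_ h.1 <;>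
            simp only [List.length_append, List.length_take] <;> omega
        · refine e.resOut_eq ?_ ?_ h.2 <;>
            simp only [List.length_append, List.length_take] <;> omega) (y.drop x.length)
    simp only [Prod.mk.injEq] at h1
    have h3 := same (x.zip (y.take x.length)) [] t (.inl rfl) (Nat.zero_le _) (h2.trans hcard)
    have h4 := Set.ext_iff.1 h1.1 []
    have h5 := Set.ext_iff.1 h1.2 []
    rw [hx, hy] at h3
    simp only [resOut, Set.mem_ofPred_eq, List.append_nil, List.take_append_drop] at h3 h4 h5
    rw [← h4, ← h5, h3]
  · have hx : ((x.take y.length).zip y).map Prod.fst = x.take y.length := by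
      rw [List.map_fst_zip]; simp
    have hy : ((x.take y.length).zip y).map Prod.snd = y := by
      rw [List.map_snd_zip]; simp; omega
    obtain ⟨t, h1, h2⟩ := exists_short
      (f := fun t => (resIn R (u ++ (x.take y.length ++ t)) (v ++ y),
        resIn R (u' ++ (x.take y.length ++ t)) (v' ++ y)))
      (c := fun t => (e.code (u ++ (x.take y.length ++ t)) (v ++ y),
        e.code (u' ++ (x.take y.length ++ t)) (v' ++ y)))
      (fun w w' t h => by
        simp only [Prod.mk.injEq] at h ⊢
        exact ⟨by simpa using resIn_append_congr h.1 t, by simpa using resIn_append_congr h.2 t⟩)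
      (fun w w' h => by
        simp only [Prod.mk.injEq] at h ⊢
        constructor
        · refine e.resIn_eq ?_ ?_ h.1 <;>
            simp only [List.length_append, List.length_take] <;> omega
        · refine e.resIn_eq ?_ ?_ h.2 <;>
            simp only [List.length_append, List.length_take] <;> omega) (x.drop y.length)
    simp only [Prod.mk.injEq] at h1
    have h3 := same ((x.take y.length).zip y) t [] (.inr rfl) (h2.trans hcard) (Nat.zero_le _)
    have h4 := mem_iff_of_resIn_eq h1.1 []
    have h5 := mem_iff_of_resIn_eq h1.2 []
    rw [hx, hy] at h3
    simp only [List.append_nil, List.take_append_drop] at h3 h4 h5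
    rw [← h4, ← h5, h3]

theorem good_iff_goodB {W : List (List α × List β × List α)}
    (hW : ∀ p ∈ W, p.1.length = p.2.1.length) {u : List α} {v : List β}
    (huv : u.length = v.length) (x z : List α) :
    Good R {p | p ∈ W} u v x z ↔ GoodB R B W u v x z := by
  refine or_congr (covered_iff_coveredB e hB huv _) (exists_congr fun y => ?_)
  constructor
  · rintro ⟨hy, hs, u', v', hp, hres⟩
    refine ⟨hy.le, hy, (safe_iff_safeB e hB huv hy z).1 hs, _, hp, rfl, ?_⟩
    exact (res_eq_iff_resEqB e hB (by simp only [List.length_append]; omega) (hW _ hp)).1 hres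
  · rintro ⟨-, hy, hs, ⟨u', v', z⟩, hp, rfl, hres⟩
    refine ⟨hy, (safe_iff_safeB e hB huv hy z).2 hs, u', v', hp, ?_⟩
    exact (res_eq_iff_resEqB e hB (by simp only [List.length_append]; omega) (hW _ hp)).2 hres

theorem closed_iff_closedB {W : List (List α × List β × List α)} :
    Closed R {p | p ∈ W} B ↔ ClosedB R B W := by
  constructor
  · intro h
    have hlen : ∀ p ∈ W, p.1.length = p.2.1.length := fun p hp => h.length_eq (x := p.2.2) hp
    refine ⟨h.init, fun p hp => ⟨hlen p hp, fun z _ hz => ?_⟩⟩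
    obtain ⟨z', h1, h2, h3⟩ := h.good (u := p.1) (v := p.2.1) (x := p.2.2) hp z hz
    have h4 := List.length_pos_iff.2 h1
    have h5 := h2.length_le
    refine ⟨z'.length - 1, by omega, ?_⟩
    rw [Nat.sub_add_cancel h4, ← List.prefix_iff_eq_take.1 h2]
    exact (good_iff_goodB e hB hlen (hlen p hp) _ _).1 h3
  · intro h
    have hlen : ∀ p ∈ W, p.1.length = p.2.1.length := fun p hp => (h.2 p hp).1
    refine ⟨h.1, fun hp => hlen _ hp, fun {u v x} hp z hz => ?_⟩
    obtain ⟨n, hn, hg⟩ := (h.2 _ hp).2 z hz.le hz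
    refine ⟨z.take (n + 1), ?_, List.take_prefix _ _,
      (good_iff_goodB e hB hlen (hlen _ hp) _ _).2 hg⟩
    intro h0
    have := congrArg List.length h0
    rw [List.length_take, List.length_nil] at this
    omega

end Bounded

/-- The existence of a uniformization is witnessed by a list of positions with short words. -/
theorem HasFSLSubseqUniformization.exists_closedB {α β X : Type} [Finite α] [Finite β] [Fintype X]
    {R : Set (List α × List β)} (h : HasFSLSubseqUniformization R) (e : ResidualCode R X) {B : ℕ}
    (hB : Fintype.card (ProfilePairCode X) ≤ B) :
    ∃ W : List (List α × List β × List α), W.Nodup ∧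
      (∀ p ∈ W, p.1.length ≤ B ∧ p.2.1.length ≤ B ∧ p.2.2.length ≤ B) ∧ ClosedB R B W := by
  obtain ⟨Q, _, T, hT, hfsl⟩ := h
  obtain ⟨K, hK⟩ := T.exists_closed hT hfsl
  obtain ⟨W, hW, hb⟩ := hK.exists_bounded e (card_code_le hB).1 hB
  have hb' : ∀ p ∈ W, p.1.length ≤ B ∧ p.2.1.length ≤ B ∧ p.2.2.length ≤ B := by
    rintro ⟨u, v, x⟩ h
    have h1 := hb _ _ _ h
    have h2 := hW.length_eq h
    exact ⟨h1.1, h2.symm.le.trans h1.1, h1.2⟩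
  have hfin : W.Finite := ((List.finite_length_le α B).prod
    ((List.finite_length_le β B).prod (List.finite_length_le α B))).subset hb'
  have hmem : {p | p ∈ hfin.toFinset.toList} = W := by ext p; simp
  refine ⟨hfin.toFinset.toList, Finset.nodup_toList _, fun p hp => hb' p (by simpa using hp), ?_⟩
  rw [← closed_iff_closedB e hB, hmem]
  exact hW

theorem ClosedB.hasFSLSubseqUniformization {α β X : Type} [Finite α] [Finite β] [Fintype X]
    {R : Set (List α × List β)} (e : ResidualCode R X) {B : ℕ}
    (hB : Fintype.card (ProfilePairCode X) ≤ B) {W : List (List α × List β × List α)}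
    (hb : ∀ p ∈ W, p.1.length ≤ B ∧ p.2.1.length ≤ B ∧ p.2.2.length ≤ B) (hW : ClosedB R B W) :
    HasFSLSubseqUniformization R :=
  ((closed_iff_closedB e hB).2 hW).hasFSLSubseqUniformization e
    fun _ _ _ h => ⟨(hb _ h).1, (hb _ h).2.2⟩

/-! ### Enumeration of short words -/

section WordsLE

/-- The list of all words of length at most `n` over the letters in `l`. -/
def wordsLE {A : Type*} (l : List A) : ℕ → List (List A)
  | 0 => [[]]
  | n + 1 => [] :: l.flatMap fun a => (wordsLE l n).map (a :: ·)

theorem mem_wordsLE {A : Type*} {l : List A} {n : ℕ} {w : List A} :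
    w ∈ wordsLE l n ↔ w.length ≤ n ∧ ∀ a ∈ w, a ∈ l := by
  induction n generalizing w with
  | zero => cases w <;> simp [wordsLE]
  | succ n ih =>
    cases w with
    | nil => simp [wordsLE]
    | cons a w =>
      simp only [wordsLE, List.mem_cons, List.mem_flatMap, List.mem_map, ih]
      simp
      tauto

theorem mem_wordsLE_range {k n : ℕ} {w : List ℕ} :
    w ∈ wordsLE (List.range k) n ↔ ∃ w' : List (Fin k), w'.length ≤ n ∧ w'.map Fin.val = w := by
  rw [mem_wordsLE]
  constructor
  · rintro ⟨h1, h2⟩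
    lift w to List (Fin k) using fun a ha => List.mem_range.1 (h2 a ha)
    exact ⟨w, by simpa using h1, rfl⟩
  · rintro ⟨w', h, rfl⟩
    exact ⟨by simpa using h, by simp⟩

theorem exists_mem_wordsLE_range {k n : ℕ} {p : List ℕ → Prop} :
    (∃ w ∈ wordsLE (List.range k) n, p w) ↔
      ∃ w : List (Fin k), w.length ≤ n ∧ p (w.map Fin.val) := by
  simp only [mem_wordsLE_range]
  constructor
  · rintro ⟨_, ⟨w, h, rfl⟩, hp⟩
    exact ⟨w, h, hp⟩
  · rintro ⟨w, h, hp⟩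
    exact ⟨_, ⟨w, h, rfl⟩, hp⟩

theorem forall_mem_wordsLE_range {k n : ℕ} {p : List ℕ → Prop} :
    (∀ w ∈ wordsLE (List.range k) n, p w) ↔
      ∀ w : List (Fin k), w.length ≤ n → p (w.map Fin.val) := by
  simp only [mem_wordsLE_range]
  constructor
  · exact fun h w hw => h _ ⟨w, hw, rfl⟩
  · rintro h _ ⟨w, hw, rfl⟩
    exact h w hw

end WordsLE

/-! ### The decision procedure and its correctness -/

namespace NFACode

/-- A bound for the length of the words that have to be considered. -/
def bound (c : NFACode) : ℕ :=
  -- Here `m` is the number of `ConfigCode`s for `k = 2 ^ c.states`, `x` the number of residual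
  -- codes, which are pairs of sets of `ConfigCode`s, and the result is the number of
  -- `ProfilePairCode`s over them.
  let m := c.states * (c.states * c.states + 1) ^ (2 * 2 ^ c.states)
  let x := 2 ^ m * 2 ^ m
  2 ^ (x * x) * 2 ^ (x * x) * (2 ^ (x * x) * 2 ^ (x * x))

/-- The effect of a transition on a state; `n` serves as a sink. -/
def follow (n q : ℕ) (t : ℕ × (ℕ ⊕ ℕ) × ℕ) : ℕ :=
  if (q = t.1 ∧ q < n) ∧ t.2.2 < n then t.2.2 else n

/-- `(u, v)` is in the relation of the automaton. -/
def Mem (c : NFACode) (u v : List ℕ) : Prop :=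
  ∃ l ∈ wordsLE c.transitions (u.length + v.length),
    ((l.map fun t => t.2.1).filterMap Sum.getLeft? = u ∧
      (l.map fun t => t.2.1).filterMap Sum.getRight? = v) ∧
      l.foldl (follow c.states) c.init < c.states ∧
      ∃ q ∈ c.finals, q = l.foldl (follow c.states) c.init

/-- `DomB` for codes. -/
def DomN (c : NFACode) (u v z : List ℕ) : Prop :=
  ∃ y ∈ wordsLE (List.range c.outputs) (z.length + c.bound), c.Mem (u ++ z) (v ++ y)

/-- `CoveredB` for codes. -/
def CoveredN (c : NFACode) (u v x : List ℕ) : Prop :=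
  ∀ t ∈ wordsLE (List.range c.inputs) c.bound, c.DomN u v (x ++ t) →
    ∃ y ∈ wordsLE (List.range c.outputs) x.length, c.Mem (u ++ (x ++ t)) (v ++ y)

/-- `SafeB` for codes. -/
def SafeN (c : NFACode) (u v x y z : List ℕ) : Prop :=
  ∀ t ∈ wordsLE (List.range c.inputs) c.bound, c.DomN u v (x ++ (z ++ t)) →
    c.DomN (u ++ x) (v ++ y) (z ++ t)

/-- `ResEqB` for codes. -/
def ResEqN (c : NFACode) (u v u' v' : List ℕ) : Prop :=
  ∀ x ∈ wordsLE (List.range c.inputs) (2 * c.bound),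
    ∀ y ∈ wordsLE (List.range c.outputs) (2 * c.bound),
      (c.Mem (u ++ x) (v ++ y) ↔ c.Mem (u' ++ x) (v' ++ y))

/-- `GoodB` for codes. -/
def GoodN (c : NFACode) (W : List (List ℕ × List ℕ × List ℕ)) (u v x z : List ℕ) : Prop :=
  c.CoveredN u v (x ++ z) ∨ ∃ y ∈ wordsLE (List.range c.outputs) x.length, y.length = x.length ∧
    c.SafeN u v x y z ∧ ∃ p ∈ W, p.2.2 = z ∧ c.ResEqN (u ++ x) (v ++ y) p.1 p.2.1

/-- `ClosedB` for codes. -/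
def ClosedN (c : NFACode) (W : List (List ℕ × List ℕ × List ℕ)) : Prop :=
  (∃ p ∈ W, p = ([], [], [])) ∧ ∀ p ∈ W, p.1.length = p.2.1.length ∧
    ∀ z ∈ wordsLE (List.range c.inputs) c.bound, z.length = c.bound →
      ∃ n ∈ List.range c.bound, c.GoodN W p.1 p.2.1 p.2.2 (z.take (n + 1))

/-- All positions with words of length at most the bound. -/
def positions (c : NFACode) : List (List ℕ × List ℕ × List ℕ) :=
  (wordsLE (List.range c.inputs) c.bound).flatMap fun u =>
    (wordsLE (List.range c.outputs) c.bound).flatMap fun v =>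
      (wordsLE (List.range c.inputs) c.bound).map fun x => (u, v, x)

/-- The decision procedure: search for a winning set of positions. -/
def Uniformizable (c : NFACode) : Prop :=
  ∃ W ∈ wordsLE c.positions c.positions.length, c.ClosedN W

section Correctness

variable {c : NFACode}

theorem foldl_follow_sink (n : ℕ) (l : List (ℕ × (ℕ ⊕ ℕ) × ℕ)) : l.foldl (follow n) n = n := by
  induction l with
  | nil => rfl
  | cons t l ih => simp [follow, ih]

theorem run_toNFA_iff {p q : Fin c.states} {w : List (Fin c.inputs ⊕ Fin c.outputs)} :
    Run c.toNFA p w q ↔ ∃ l : List (ℕ × (ℕ ⊕ ℕ) × ℕ), (∀ t ∈ l, t ∈ c.transitions) ∧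
      l.map (fun t => t.2.1) = w.map (Sum.map Fin.val Fin.val) ∧
      l.foldl (follow c.states) p = q := by
  induction w generalizing p with
  | nil =>
    simp only [Run, List.map_nil, List.map_eq_nil_iff]
    constructor
    · rintro rfl
      exact ⟨[], by simp⟩
    · rintro ⟨_, -, rfl, h⟩
      exact Fin.ext h
  | cons a w ih =>
    simp only [Run, ih]
    constructor
    · rintro ⟨r, hr, l, h1, h2, h3⟩
      refine ⟨((p : ℕ), a.map Fin.val Fin.val, (r : ℕ)) :: l, ?_, by simp [h2], ?_⟩
      · simpa using ⟨hr, by simpa using h1⟩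
      · simpa [follow] using h3
    · rintro ⟨l, h1, h2, h3⟩
      cases l with
      | nil => simp at h2
      | cons t l =>
        simp only [List.map_cons, List.cons.injEq, List.foldl_cons] at h2 h3
        by_cases ht : ((p : ℕ) = t.1 ∧ (p : ℕ) < c.states) ∧ t.2.2 < c.states
        · rw [show follow c.states p t = t.2.2 from if_pos ht] at h3
          refine ⟨⟨t.2.2, ht.2⟩, ?_, l, fun s hs => h1 s (List.mem_cons_of_mem _ hs), h2.2, h3⟩
          show ((p : ℕ), a.map Fin.val Fin.val, t.2.2) ∈ c.transitions
          rw [← h2.1, ht.1.1]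
          exact h1 t List.mem_cons_self
        · simp only [follow, ht, if_false] at h3
          have : List.foldl (follow c.states) c.states l = c.states := foldl_follow_sink _ l
          rw [this] at h3
          exact absurd h3 q.2.ne'

theorem exists_of_pairOf_eq_map {i o : ℕ} {s : List (ℕ ⊕ ℕ)} {u : List (Fin i)} {v : List (Fin o)}
    (h : pairOf s = (u.map Fin.val, v.map Fin.val)) :
    ∃ w : List (Fin i ⊕ Fin o), w.map (Sum.map Fin.val Fin.val) = s ∧ pairOf w = (u, v) := by
  induction s generalizing u v with
  | nil =>
    simp at h
    exact ⟨[], by simp [h]⟩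
  | cons a s ih =>
    cases a with
    | inl a =>
      simp only [pairOf_inl_cons, Prod.mk.injEq] at h
      obtain ⟨b, u', rfl, rfl, h1⟩ := List.map_eq_cons_iff.1 h.1.symm
      obtain ⟨w, rfl, hw⟩ := ih (u := u') (v := v) (Prod.ext h1.symm h.2)
      exact ⟨Sum.inl b :: w, by simp, by simp [hw]⟩
    | inr a =>
      simp only [pairOf_inr_cons, Prod.mk.injEq] at h
      obtain ⟨b, v', rfl, rfl, h1⟩ := List.map_eq_cons_iff.1 h.2.symm
      obtain ⟨w, rfl, hw⟩ := ih (u := u) (v := v') (Prod.ext h.1 h1.symm)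
      exact ⟨Sum.inr b :: w, by simp, by simp [hw]⟩

theorem pairOf_map_sumMap {i o : ℕ} (w : List (Fin i ⊕ Fin o)) :
    pairOf (w.map (Sum.map Fin.val Fin.val)) =
      ((pairOf w).1.map Fin.val, (pairOf w).2.map Fin.val) := by
  induction w with
  | nil => rfl
  | cons a w ih => cases a <;> simp [ih]

theorem length_eq_pairOf {α β : Type*} (w : List (α ⊕ β)) :
    w.length = (pairOf w).1.length + (pairOf w).2.length := by
  induction w with
  | nil => rfl
  | cons a w ih => cases a <;> simp [ih] <;> omega

theorem mem_iff {u : List (Fin c.inputs)} {v : List (Fin c.outputs)} :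
    c.Mem (u.map Fin.val) (v.map Fin.val) ↔ (u, v) ∈ relOf c.language := by
  rw [language, mem_relOf_accepts]
  constructor
  · rintro ⟨l, hl, ⟨h1, h2⟩, h3, q, h4, h5⟩
    have hpair : pairOf (l.map fun t => t.2.1) = (u.map Fin.val, v.map Fin.val) := Prod.ext h1 h2
    obtain ⟨w, hw, hw'⟩ := exists_of_pairOf_eq_map hpair
    -- If `c.init` is not a state, then the fold ends in `c.init` itself or in the sink `c.states`,
    -- never below `c.states`.
    have hinit : c.init < c.states := by
      by_contra hc
      cases l with
      | nil => exact hc h3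
      | cons t l =>
        simp only [List.foldl_cons, follow, hc, and_false, false_and, if_false] at h3
        have : List.foldl (follow c.states) c.states l = c.states := foldl_follow_sink _ l
        rw [this] at h3
        exact lt_irrefl _ h3
    subst h5
    refine ⟨⟨c.init, hinit⟩, rfl, ⟨_, h3⟩, h4, w, hw', run_toNFA_iff.2 ⟨l, ?_, hw.symm, rfl⟩⟩
    exact (mem_wordsLE.1 hl).2
  · rintro ⟨p, hp, f, hf, w, hw, hr⟩
    obtain ⟨l, h1, h2, h3⟩ := run_toNFA_iff.1 hr
    have hp' : (p : ℕ) = c.init := hp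
    rw [hp'] at h3
    have hpair := pairOf_map_sumMap w
    rw [← h2, hw] at hpair
    refine ⟨l, mem_wordsLE.2 ⟨?_, h1⟩, ⟨congrArg Prod.fst hpair, congrArg Prod.snd hpair⟩,
      h3 ▸ f.2, f, hf, h3.symm⟩
    have := congrArg List.length h2
    simp only [List.length_map] at this ⊢
    rw [this, length_eq_pairOf w, hw]

theorem domN_iff {u z : List (Fin c.inputs)} {v : List (Fin c.outputs)} :
    c.DomN (u.map Fin.val) (v.map Fin.val) (z.map Fin.val) ↔
      DomB (relOf c.language) c.bound u v z := by
  simp only [DomN, DomB, exists_mem_wordsLE_range, ← List.map_append, mem_iff, List.length_map]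

theorem coveredN_iff {u x : List (Fin c.inputs)} {v : List (Fin c.outputs)} :
    c.CoveredN (u.map Fin.val) (v.map Fin.val) (x.map Fin.val) ↔
      CoveredB (relOf c.language) c.bound u v x := by
  simp only [CoveredN, CoveredB, exists_mem_wordsLE_range, forall_mem_wordsLE_range,
    ← List.map_append, mem_iff, domN_iff, List.length_map]

theorem safeN_iff {u x z : List (Fin c.inputs)} {v y : List (Fin c.outputs)} :
    c.SafeN (u.map Fin.val) (v.map Fin.val) (x.map Fin.val) (y.map Fin.val) (z.map Fin.val) ↔
      SafeB (relOf c.language) c.bound u v x y z := by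
  simp only [SafeN, SafeB, forall_mem_wordsLE_range, ← List.map_append, domN_iff]

theorem resEqN_iff {u u' : List (Fin c.inputs)} {v v' : List (Fin c.outputs)} :
    c.ResEqN (u.map Fin.val) (v.map Fin.val) (u'.map Fin.val) (v'.map Fin.val) ↔
      ResEqB (relOf c.language) c.bound u v u' v' := by
  simp only [ResEqN, ResEqB, forall_mem_wordsLE_range, ← List.map_append, mem_iff]

/-- Positions as triples of words over the natural numbers. -/
def toPosition {i o : ℕ} (p : List (Fin i) × List (Fin o) × List (Fin i)) :
    List ℕ × List ℕ × List ℕ :=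
  (p.1.map Fin.val, p.2.1.map Fin.val, p.2.2.map Fin.val)

theorem map_val_injective (k : ℕ) : Function.Injective (List.map (Fin.val : Fin k → ℕ)) :=
  List.map_injective_iff.2 Fin.val_injective

theorem toPosition_injective (i o : ℕ) : Function.Injective (toPosition (i := i) (o := o)) := by
  rintro ⟨u, v, x⟩ ⟨u', v', x'⟩ h
  simp only [toPosition, Prod.mk.injEq] at h
  rw [map_val_injective _ h.1, map_val_injective _ h.2.1, map_val_injective _ h.2.2]

theorem goodN_iff {W : List (List (Fin c.inputs) × List (Fin c.outputs) × List (Fin c.inputs))}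
    {u x z : List (Fin c.inputs)} {v : List (Fin c.outputs)} :
    c.GoodN (W.map toPosition) (u.map Fin.val) (v.map Fin.val) (x.map Fin.val) (z.map Fin.val) ↔
      GoodB (relOf c.language) c.bound W u v x z := by
  simp only [GoodN, GoodB, exists_mem_wordsLE_range, ← List.map_append, coveredN_iff, safeN_iff,
    List.length_map, List.mem_map, exists_exists_and_eq_and, toPosition, resEqN_iff, (map_val_injective _).eq_iff]

theorem closedN_iff
    {W : List (List (Fin c.inputs) × List (Fin c.outputs) × List (Fin c.inputs))} :
    c.ClosedN (W.map toPosition) ↔ ClosedB (relOf c.language) c.bound W := by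
  have hnil : (([], [], []) : List ℕ × List ℕ × List ℕ) =
      toPosition (([], [], []) : List (Fin c.inputs) × List (Fin c.outputs) × _) := rfl
  simp only [ClosedN, ClosedB, hnil, exists_eq_right, List.mem_map, forall_exists_index, and_imp,
    forall_apply_eq_imp_iff₂, (toPosition_injective _ _).eq_iff, forall_mem_wordsLE_range]
  simp only [toPosition, List.length_map, ← List.map_take, goodN_iff, List.mem_range]

theorem mem_positions {p : List ℕ × List ℕ × List ℕ} :
    p ∈ c.positions ↔ ∃ p' : List (Fin c.inputs) × List (Fin c.outputs) × List (Fin c.inputs),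
      (p'.1.length ≤ c.bound ∧ p'.2.1.length ≤ c.bound ∧ p'.2.2.length ≤ c.bound) ∧
        toPosition p' = p := by
  simp only [positions, List.mem_flatMap, List.mem_map, mem_wordsLE_range, toPosition]
  constructor
  · rintro ⟨_, ⟨u, hu, rfl⟩, _, ⟨v, hv, rfl⟩, _, ⟨x, hx, rfl⟩, rfl⟩
    exact ⟨(u, v, x), ⟨hu, hv, hx⟩, rfl⟩
  · rintro ⟨⟨u, v, x⟩, ⟨hu, hv, hx⟩, rfl⟩
    exact ⟨_, ⟨u, hu, rfl⟩, _, ⟨v, hv, rfl⟩, _, ⟨x, hx, rfl⟩, rfl⟩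

theorem card_profilePairCode (X : Type*) [Fintype X] :
    Fintype.card (ProfilePairCode X) = 2 ^ (Fintype.card X * Fintype.card X) *
      2 ^ (Fintype.card X * Fintype.card X) * (2 ^ (Fintype.card X * Fintype.card X) *
      2 ^ (Fintype.card X * Fintype.card X)) := by
  simp only [ProfilePairCode, Fintype.card_prod, Fintype.card_set]

/-- Finite shiftlag enters only here, through the residual code of the automaton; the procedure
itself depends on the code `c` alone, and `c.bound` is the cardinality that the game arguments
require. -/
theorem uniformizable_iff (h : FiniteShiftlag c.language) :
    c.Uniformizable ↔ HasFSLSubseqUniformization (relOf c.language) := by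
  have e := configResidualCode c.toNFA _ h.fewShiftsAfterLag
  have hB := (card_profilePairCode (Set (ConfigCode (Fin c.states)
    (2 * Fintype.card (Set (Fin c.states)))) × Set (ConfigCode (Fin c.states)
    (2 * Fintype.card (Set (Fin c.states)))))).le
  have hcard : Fintype.card (Set (ConfigCode (Fin c.states)
      (2 * Fintype.card (Set (Fin c.states)))) × Set (ConfigCode (Fin c.states)
      (2 * Fintype.card (Set (Fin c.states))))) =
      2 ^ (c.states * (c.states * c.states + 1) ^ (2 * 2 ^ c.states)) *
      2 ^ (c.states * (c.states * c.states + 1) ^ (2 * 2 ^ c.states)) := by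
    simp only [ConfigCode, Fintype.card_prod, Fintype.card_set, Fintype.card_fun,
      Fintype.card_option, Fintype.card_fin]
  rw [hcard] at hB
  constructor
  · rintro ⟨W, hW, hc⟩
    have hpos := (mem_wordsLE.1 hW).2
    obtain ⟨W', rfl, hb⟩ : ∃ W' : List (List (Fin c.inputs) × List (Fin c.outputs) ×
        List (Fin c.inputs)), W'.map toPosition = W ∧ ∀ p ∈ W', p.1.length ≤ c.bound ∧
          p.2.1.length ≤ c.bound ∧ p.2.2.length ≤ c.bound := by
      clear hc hW
      induction W with
      | nil => exact ⟨[], by simp⟩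
      | cons p W ih =>
        obtain ⟨W', rfl, h1⟩ := ih fun a ha => hpos a (List.mem_cons_of_mem _ ha)
        obtain ⟨p', h2, rfl⟩ := mem_positions.1 (hpos p List.mem_cons_self)
        exact ⟨p' :: W', rfl, by simpa using ⟨h2, by simpa using h1⟩⟩
    exact (closedN_iff.1 hc).hasFSLSubseqUniformization e hB hb
  · intro hu
    obtain ⟨W, hnd, hb, hW⟩ := hu.exists_closedB e hB
    have hmem : ∀ p ∈ W.map toPosition, p ∈ c.positions := by
      intro p hp
      obtain ⟨p', hp', rfl⟩ := List.mem_map.1 hp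
      exact mem_positions.2 ⟨p', hb p' hp', rfl⟩
    refine ⟨W.map toPosition, mem_wordsLE.2 ⟨?_, hmem⟩, closedN_iff.2 hW⟩
    -- A winning set without repetitions has at most as many elements as there are positions, which
    -- is the length up to which candidates are searched.
    exact (List.subperm_of_subset (hnd.map (toPosition_injective _ _)) hmem).length_le

end Correctness

end NFACode

/-! ### Primitive recursiveness of the decision procedure -/

section Primrec

variable {γ A : Type*} [Primcodable γ] [Primcodable A]

/-- Every quantifier of the procedure ranges over a computed list, so this lemma and its universal
counterpart reduce its computability to that of `Mem`. -/
theorem primrecPred_exists_mem {f : γ → List A} {p : γ → A → Prop} (hf : Primrec f)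
    (hp : PrimrecPred fun x : γ × A => p x.1 x.2) : PrimrecPred fun c => ∃ a ∈ f c, p c a :=
  (PrimrecRel.exists_mem_list (R := fun a c => p c a)
    (hp.comp (Primrec.snd.pair Primrec.fst))).comp hf Primrec.id

theorem primrecPred_forall_mem {f : γ → List A} {p : γ → A → Prop} (hf : Primrec f)
    (hp : PrimrecPred fun x : γ × A => p x.1 x.2) : PrimrecPred fun c => ∀ a ∈ f c, p c a :=
  (PrimrecRel.forall_mem_list (R := fun a c => p c a)
    (hp.comp (Primrec.snd.pair Primrec.fst))).comp hf Primrec.id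

theorem primrecPred_imp {p q : γ → Prop} (hp : PrimrecPred p) (hq : PrimrecPred q) :
    PrimrecPred fun c => p c → q c :=
  (hp.not.or hq).of_eq fun c => by tauto

theorem primrecPred_iff {p q : γ → Prop} (hp : PrimrecPred p) (hq : PrimrecPred q) :
    PrimrecPred fun c => p c ↔ q c :=
  ((primrecPred_imp hp hq).and (primrecPred_imp hq hp)).of_eq fun c => by tauto

theorem primrec_pow : Primrec₂ fun a b : ℕ => a ^ b := by
  refine (Primrec.nat_rec (f := fun _ : ℕ => 1) (g := fun (a : ℕ) (x : ℕ × ℕ) => x.2 * a)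
    (Primrec.const 1) ?_).of_eq ?_
  · exact Primrec.nat_mul.comp (Primrec.snd.comp Primrec.snd) Primrec.fst
  · intro a b
    induction b with
    | zero => rfl
    | succ b ih => simp only [pow_succ, ← ih]

theorem primrec_wordsLE : Primrec₂ (wordsLE : List A → ℕ → List (List A)) := by
  refine (Primrec.nat_rec (f := fun _ : List A => [[]])
    (g := fun (l : List A) (x : ℕ × List (List A)) =>
      [] :: l.flatMap fun a => x.2.map (a :: ·)) (Primrec.const _) ?_).of_eq ?_
  · refine Primrec.list_cons.comp (Primrec.const _) (Primrec.list_flatMap Primrec.fst ?_)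
    refine Primrec.list_map (Primrec.snd.comp (Primrec.snd.comp Primrec.fst)) ?_
    exact Primrec.list_cons.comp (Primrec.snd.comp Primrec.fst) Primrec.snd
  · intro l n
    induction n with
    | zero => rfl
    | succ n ih => simp only [wordsLE, ← ih]

theorem primrec_getLeft? {B : Type*} [Primcodable B] :
    Primrec (Sum.getLeft? : A ⊕ B → Option A) :=
  (Primrec.sumCasesOn (f := id) (g := fun (_ : A ⊕ B) a => some a) (h := fun _ _ => none)
    Primrec.id (Primrec.option_some.comp Primrec.snd) (Primrec.const none)).of_eq
    fun x => by cases x <;> rfl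

theorem primrec_getRight? {B : Type*} [Primcodable B] :
    Primrec (Sum.getRight? : A ⊕ B → Option B) :=
  (Primrec.sumCasesOn (f := id) (g := fun (_ : A ⊕ B) _ => none) (h := fun _ b => some b)
    Primrec.id (Primrec.const none) (Primrec.option_some.comp Primrec.snd)).of_eq
    fun x => by cases x <;> rfl

end Primrec

namespace NFACode

theorem primrec_equivTuple : Primrec equivTuple := Primrec.of_equiv

theorem primrec_inputs : Primrec inputs :=
  (Primrec.fst.comp primrec_equivTuple).of_eq fun _ => rfl

theorem primrec_outputs : Primrec outputs :=
  (Primrec.fst.comp (Primrec.snd.comp primrec_equivTuple)).of_eq fun _ => rfl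

theorem primrec_states : Primrec states :=
  (Primrec.fst.comp (Primrec.snd.comp (Primrec.snd.comp primrec_equivTuple))).of_eq fun _ => rfl

theorem primrec_init : Primrec init :=
  (Primrec.fst.comp (Primrec.snd.comp (Primrec.snd.comp (Primrec.snd.comp
    primrec_equivTuple)))).of_eq fun _ => rfl

theorem primrec_transitions : Primrec transitions :=
  (Primrec.fst.comp (Primrec.snd.comp (Primrec.snd.comp (Primrec.snd.comp (Primrec.snd.comp
    primrec_equivTuple))))).of_eq fun _ => rfl

theorem primrec_finals : Primrec finals :=
  (Primrec.snd.comp (Primrec.snd.comp (Primrec.snd.comp (Primrec.snd.comp (Primrec.snd.comp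
    primrec_equivTuple))))).of_eq fun _ => rfl

theorem primrec_bound : Primrec bound := by
  have two : Primrec fun _ : NFACode => 2 := Primrec.const 2
  have hm : Primrec fun c : NFACode =>
      c.states * (c.states * c.states + 1) ^ (2 * 2 ^ c.states) :=
    Primrec.nat_mul.comp primrec_states (primrec_pow.comp
      (Primrec.succ.comp (Primrec.nat_mul.comp primrec_states primrec_states))
      (Primrec.nat_mul.comp two (primrec_pow.comp two primrec_states)))
  have hx := primrec_pow.comp two hm
  have hx := Primrec.nat_mul.comp hx hx
  have hy := primrec_pow.comp two (Primrec.nat_mul.comp hx hx)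
  have hy := Primrec.nat_mul.comp hy hy
  exact Primrec.nat_mul.comp hy hy

variable {γ : Type*} [Primcodable γ] {c : γ → NFACode} {u v x y z u' v' : γ → List ℕ}

theorem primrecPred_mem (hc : Primrec c) (hu : Primrec u) (hv : Primrec v) :
    PrimrecPred fun g => (c g).Mem (u g) (v g) := by
  have hstep : Primrec fun p : ℕ × ℕ × ℕ × (ℕ ⊕ ℕ) × ℕ => follow p.1 p.2.1 p.2.2 := by
    have h1 : Primrec fun p : ℕ × ℕ × ℕ × (ℕ ⊕ ℕ) × ℕ => p.1 := Primrec.fst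
    have h2 : Primrec fun p : ℕ × ℕ × ℕ × (ℕ ⊕ ℕ) × ℕ => p.2.1 := Primrec.fst.comp Primrec.snd
    have h3 : Primrec fun p : ℕ × ℕ × ℕ × (ℕ ⊕ ℕ) × ℕ => p.2.2.1 :=
      Primrec.fst.comp (Primrec.snd.comp Primrec.snd)
    have h4 : Primrec fun p : ℕ × ℕ × ℕ × (ℕ ⊕ ℕ) × ℕ => p.2.2.2.2 :=
      Primrec.snd.comp (Primrec.snd.comp (Primrec.snd.comp Primrec.snd))
    exact Primrec.ite (((Primrec.eq.comp h2 h3).and (Primrec.nat_lt.comp h2 h1)).and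
      (Primrec.nat_lt.comp h4 h1)) h4 h1
  have hc' : Primrec fun q : γ × List (ℕ × (ℕ ⊕ ℕ) × ℕ) => c q.1 := hc.comp Primrec.fst
  have hletters : Primrec fun q : γ × List (ℕ × (ℕ ⊕ ℕ) × ℕ) => q.2.map fun t => t.2.1 :=
    Primrec.list_map Primrec.snd (Primrec.fst.comp (Primrec.snd.comp Primrec.snd))
  have hstep' : Primrec₂ fun (q : γ × List (ℕ × (ℕ ⊕ ℕ) × ℕ)) (s : ℕ × ℕ × (ℕ ⊕ ℕ) × ℕ) =>
      follow (c q.1).states s.1 s.2 :=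
    hstep.comp ((primrec_states.comp (hc'.comp Primrec.fst)).pair Primrec.snd)
  have hfold : Primrec fun q : γ × List (ℕ × (ℕ ⊕ ℕ) × ℕ) =>
      q.2.foldl (follow (c q.1).states) (c q.1).init :=
    Primrec.list_foldl Primrec.snd (primrec_init.comp hc') hstep'
  refine primrecPred_exists_mem (primrec_wordsLE.comp (primrec_transitions.comp hc)
    (Primrec.nat_add.comp (Primrec.list_length.comp hu) (Primrec.list_length.comp hv))) ?_
  refine .and (.and ?_ ?_) (.and ?_ ?_)
  · exact Primrec.eq.comp (Primrec.listFilterMap hletters (primrec_getLeft?.comp Primrec.snd))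
      (hu.comp Primrec.fst)
  · exact Primrec.eq.comp (Primrec.listFilterMap hletters (primrec_getRight?.comp Primrec.snd))
      (hv.comp Primrec.fst)
  · exact Primrec.nat_lt.comp hfold (primrec_states.comp hc')
  · exact primrecPred_exists_mem (primrec_finals.comp hc')
      (Primrec.eq.comp Primrec.snd (hfold.comp Primrec.fst))

theorem primrec_inputWords {n : γ → ℕ} (hc : Primrec c) (hn : Primrec n) :
    Primrec fun g => wordsLE (List.range (c g).inputs) (n g) :=
  primrec_wordsLE.comp (Primrec.list_range.comp (primrec_inputs.comp hc)) hn

theorem primrec_outputWords {n : γ → ℕ} (hc : Primrec c) (hn : Primrec n) :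
    Primrec fun g => wordsLE (List.range (c g).outputs) (n g) :=
  primrec_wordsLE.comp (Primrec.list_range.comp (primrec_outputs.comp hc)) hn

theorem primrecPred_domN (hc : Primrec c) (hu : Primrec u) (hv : Primrec v) (hz : Primrec z) :
    PrimrecPred fun g => (c g).DomN (u g) (v g) (z g) :=
  primrecPred_exists_mem (primrec_outputWords hc
      (Primrec.nat_add.comp (Primrec.list_length.comp hz) (primrec_bound.comp hc)))
    (primrecPred_mem (hc.comp Primrec.fst)
      (Primrec.list_append.comp (hu.comp Primrec.fst) (hz.comp Primrec.fst))
      (Primrec.list_append.comp (hv.comp Primrec.fst) Primrec.snd))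

theorem primrecPred_coveredN (hc : Primrec c) (hu : Primrec u) (hv : Primrec v)
    (hx : Primrec x) : PrimrecPred fun g => (c g).CoveredN (u g) (v g) (x g) := by
  have hxt := Primrec.list_append.comp (hx.comp (Primrec.fst (β := List ℕ))) Primrec.snd
  refine primrecPred_forall_mem (primrec_inputWords hc (primrec_bound.comp hc))
    (primrecPred_imp (primrecPred_domN (hc.comp Primrec.fst) (hu.comp Primrec.fst)
      (hv.comp Primrec.fst) hxt) ?_)
  refine primrecPred_exists_mem (primrec_outputWords (hc.comp Primrec.fst)
    (Primrec.list_length.comp (hx.comp Primrec.fst))) ?_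
  exact primrecPred_mem (hc.comp (Primrec.fst.comp Primrec.fst))
    (Primrec.list_append.comp (hu.comp (Primrec.fst.comp Primrec.fst)) (hxt.comp Primrec.fst))
    (Primrec.list_append.comp (hv.comp (Primrec.fst.comp Primrec.fst)) Primrec.snd)

theorem primrecPred_safeN (hc : Primrec c) (hu : Primrec u) (hv : Primrec v)
    (hx : Primrec x) (hy : Primrec y) (hz : Primrec z) :
    PrimrecPred fun g => (c g).SafeN (u g) (v g) (x g) (y g) (z g) := by
  have hzt := Primrec.list_append.comp (hz.comp (Primrec.fst (β := List ℕ))) Primrec.snd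
  exact primrecPred_forall_mem (primrec_inputWords hc (primrec_bound.comp hc))
    (primrecPred_imp
      (primrecPred_domN (hc.comp Primrec.fst) (hu.comp Primrec.fst) (hv.comp Primrec.fst)
        (Primrec.list_append.comp (hx.comp Primrec.fst) hzt))
      (primrecPred_domN (hc.comp Primrec.fst)
        (Primrec.list_append.comp (hu.comp Primrec.fst) (hx.comp Primrec.fst))
        (Primrec.list_append.comp (hv.comp Primrec.fst) (hy.comp Primrec.fst)) hzt))

theorem primrecPred_resEqN (hc : Primrec c) (hu : Primrec u) (hv : Primrec v)
    (hu' : Primrec u') (hv' : Primrec v') :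
    PrimrecPred fun g => (c g).ResEqN (u g) (v g) (u' g) (v' g) := by
  have hb := Primrec.nat_mul.comp (Primrec.const 2) (primrec_bound.comp hc)
  have h0 := Primrec.fst.comp (Primrec.fst (α := γ × List ℕ) (β := List ℕ))
  have h1 := Primrec.snd.comp (Primrec.fst (α := γ × List ℕ) (β := List ℕ))
  refine primrecPred_forall_mem (primrec_inputWords hc hb)
    (primrecPred_forall_mem (primrec_outputWords (hc.comp Primrec.fst) (hb.comp Primrec.fst)) ?_)
  exact primrecPred_iff
    (primrecPred_mem (hc.comp h0) (Primrec.list_append.comp (hu.comp h0) h1)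
      (Primrec.list_append.comp (hv.comp h0) Primrec.snd))
    (primrecPred_mem (hc.comp h0) (Primrec.list_append.comp (hu'.comp h0) h1)
      (Primrec.list_append.comp (hv'.comp h0) Primrec.snd))

theorem primrecPred_goodN {W : γ → List (List ℕ × List ℕ × List ℕ)} (hc : Primrec c)
    (hW : Primrec W) (hu : Primrec u) (hv : Primrec v) (hx : Primrec x) (hz : Primrec z) :
    PrimrecPred fun g => (c g).GoodN (W g) (u g) (v g) (x g) (z g) := by
  have f1 := Primrec.fst (α := γ) (β := List ℕ)
  have f2 := f1.comp (Primrec.fst (α := γ × List ℕ) (β := List ℕ × List ℕ × List ℕ))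
  have s2 := Primrec.snd (α := γ × List ℕ) (β := List ℕ × List ℕ × List ℕ)
  refine .or (primrecPred_coveredN hc hu hv (Primrec.list_append.comp hx hz)) ?_
  refine primrecPred_exists_mem (primrec_outputWords hc (Primrec.list_length.comp hx)) ?_
  refine .and (Primrec.eq.comp (Primrec.list_length.comp Primrec.snd)
    (Primrec.list_length.comp (hx.comp f1))) (.and ?_ ?_)
  · exact primrecPred_safeN (hc.comp f1) (hu.comp f1) (hv.comp f1) (hx.comp f1) Primrec.snd
      (hz.comp f1)
  · refine primrecPred_exists_mem (hW.comp f1) (.and ?_ ?_)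
    · exact Primrec.eq.comp (Primrec.snd.comp (Primrec.snd.comp s2)) (hz.comp f2)
    · exact primrecPred_resEqN (hc.comp f2)
        (Primrec.list_append.comp (hu.comp f2) (hx.comp f2))
        (Primrec.list_append.comp (hv.comp f2) (Primrec.snd.comp Primrec.fst))
        (Primrec.fst.comp s2) (Primrec.fst.comp (Primrec.snd.comp s2))

theorem primrecPred_closedN {W : γ → List (List ℕ × List ℕ × List ℕ)} (hc : Primrec c)
    (hW : Primrec W) : PrimrecPred fun g => (c g).ClosedN (W g) := by
  have f1 := Primrec.fst (α := γ) (β := List ℕ × List ℕ × List ℕ)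
  have s1 := Primrec.snd (α := γ) (β := List ℕ × List ℕ × List ℕ)
  have f2 := Primrec.fst (α := γ × List ℕ × List ℕ × List ℕ) (β := List ℕ)
  have f3 := Primrec.fst (α := (γ × List ℕ × List ℕ × List ℕ) × List ℕ) (β := ℕ)
  have hb := primrec_bound.comp (hc.comp f1)
  refine .and (primrecPred_exists_mem hW (Primrec.eq.comp Primrec.snd (Primrec.const _)))
    (primrecPred_forall_mem hW (.and ?_ ?_))
  · exact Primrec.eq.comp (Primrec.list_length.comp (Primrec.fst.comp s1))
      (Primrec.list_length.comp (Primrec.fst.comp (Primrec.snd.comp s1)))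
  refine primrecPred_forall_mem (primrec_inputWords (hc.comp f1) hb) (primrecPred_imp
    (Primrec.eq.comp (Primrec.list_length.comp Primrec.snd) (hb.comp f2)) ?_)
  refine primrecPred_exists_mem (Primrec.list_range.comp (hb.comp f2)) ?_
  have p3 := s1.comp (f2.comp f3)
  exact primrecPred_goodN (hc.comp (f1.comp (f2.comp f3))) (hW.comp (f1.comp (f2.comp f3)))
    (Primrec.fst.comp p3) (Primrec.fst.comp (Primrec.snd.comp p3))
    (Primrec.snd.comp (Primrec.snd.comp p3))
    (Primrec.list_take.comp (Primrec.succ.comp Primrec.snd) (Primrec.snd.comp f3))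

theorem primrec_positions : Primrec positions := by
  have h1 := primrec_inputWords Primrec.id primrec_bound
  have h2 := primrec_outputWords Primrec.id primrec_bound
  refine Primrec.list_flatMap h1 (Primrec.list_flatMap (h2.comp Primrec.fst)
    (Primrec.list_map (h1.comp (Primrec.fst.comp Primrec.fst)) ?_))
  exact (Primrec.snd.comp (Primrec.fst.comp Primrec.fst)).pair
    ((Primrec.snd.comp Primrec.fst).pair Primrec.snd)

theorem primrecPred_uniformizable : PrimrecPred Uniformizable :=
  primrecPred_exists_mem (primrec_wordsLE.comp primrec_positions
    (Primrec.list_length.comp primrec_positions)) (primrecPred_closedN Primrec.fst Primrec.snd)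

theorem computablePred_uniformizable : ComputablePred Uniformizable := by
  obtain ⟨h, hp⟩ := primrecPred_uniformizable
  exact ⟨h, hp.to_comp⟩

end NFACode

end Sync

theorem mainTheorem3 :
    ∃ P : Sync.NFACode → Prop, ComputablePred P ∧
      ∀ c : Sync.NFACode, Sync.FiniteShiftlag c.language →
        (P c ↔ Sync.HasFSLSubseqUniformization (Sync.relOf c.language)) :=
  ⟨_, Sync.NFACode.computablePred_uniformizable, fun _ h => Sync.NFACode.uniformizable_iff h⟩
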